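/- Let $m\ge 1$ and let $1\le p_j\le q_j<\infty$ for $1\le j\le m$; put $1/r_j=1/p_j-1/q_j$ (so $1<r_j\le\infty$) and $1/q=1/q_1+\dots+1/q_m$. For each $j$ let $X_j$ be a real Banach lattice that is $p_j$-convex with constant $M^{(p_j)}(X_j)\le 1$, i.e. $$\Big\|\Big(\sum_{k=1}^n|x_k|^{p_j}\Big)^{1/p_j}\Big\|_{X_j}\le\Big(\sum_{k=1}^n\|x_k\|_{X_j}^{p_j}\Big)^{1/p_j}$$ for all finite sequences $(x_k)$ in $X_j$, where $(\sum_k|x_k|^{p_j})^{1/p_j}$ is defined by Krivine's functional calculus. Let $(X_j)_{p_j}$ be the $p_j$-concavification of $X_j$: it consists of the elements $x^{p_j}$, $x\in X_j$ (signed powers), with the order of $X_j$, with $x^{p_j}+y^{p_j}=\big((x^{p_j}+y^{p_j})^{1/p_j}\big)^{p_j}$ and $c\,x^{p_j}=(c^{1/p_j}x)^{p_j}$ (the inner expression computed by the functional calculus in $X_j$, with signed powers), and with norm $\|x^{p_j}\|=\|x\|_{X_j}^{p_j}$. Let $B_j^+$ be the set of positive functionals in the closed unit ball of the dual of $(X_j)_{p_j}$,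 with the weak* topology. Let $E$ be a real Banach space and $T\colon X_1\times\dots\times X_m\to E$ an $m$-linear map. Then the following are equivalent. (i) $T$ is $(p_1,\dots,p_m)$-strongly $(q_1,\dots,q_m)$-concave: there is a constant $C>0$ such that for every $n$ and all finite sequences $(x_k^j)_{k=1}^n$ in $X_j$, $1\le j\le m$, $$\Big(\sum_{k=1}^n\|T(x_k^1,\dots,x_k^m)\|_E^q\Big)^{1/q}\le C\prod_{j=1}^m\ \sup_{(\beta_k)\in B_{\ell_{r_j}^n}}\Big\|\Big(\sum_{k=1}^n|\beta_kx_k^j|^{p_j}\Big)^{1/p_j}\Big\|_{X_j},$$ where $B_{\ell_{r_j}^n}$ is the closed unit ball of $\ell_{r_j}^n$. (ii) There are a constant $C>0$ and Borel probability measures $\nu_j$ on $B_j^+$, $1\le j\le m$, such that for every $(x_1,\dots,x_m)\in X_1\times\dots\times X_m$, $$\|T(x_1,\dots,x_m)\|_E\le C\prod_{j=1}^m\Big(\int_{B_j^+}\big\langle|x_j|^{p_j},x^*\big\rangle^{q_j/p_j}\,d\nu_j(x^*)\Big)^{1/q_j}.$$ -/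

import Mathlib

open MeasureTheory
open scoped ENNReal

set_option linter.unusedSectionVars false

/-- The real-valued functions on `ℝ^ι` that are continuous and positively homogeneous of
degree one. -/
def PosHomog (ι : Type*) : Submodule ℝ ((ι → ℝ) → ℝ) where
  carrier := {f | Continuous f ∧ ∀ (c : ℝ) (s : ι → ℝ), 0 ≤ c → f (c • s) = c * f s}
  add_mem' := by
    rintro f g ⟨hf, hf'⟩ ⟨hg, hg'⟩
    refine ⟨hf.add hg, fun c s hc => ?_⟩
    simp only [Pi.add_apply, hf' c s hc, hg' c s hc]
    ring
  zero_mem' := ⟨continuous_zero, fun c s _ => by simp⟩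
  smul_mem' := by
    rintro a f ⟨hf, hf'⟩
    refine ⟨hf.const_smul a, fun c s hc => ?_⟩
    simp only [Pi.smul_apply, smul_eq_mul, hf' c s hc]
    ring

namespace PosHomog

variable {ι : Type*}

theorem coord_mem (i : ι) : (fun s : ι → ℝ => s i) ∈ PosHomog ι :=
  ⟨continuous_apply i, fun c s _ => by simp⟩

theorem sup_mem {f g : (ι → ℝ) → ℝ} (hf : f ∈ PosHomog ι) (hg : g ∈ PosHomog ι) :
    f ⊔ g ∈ PosHomog ι :=
  ⟨hf.1.sup hg.1, fun c s hc => by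
    simp only [Pi.sup_apply, hf.2 c s hc, hg.2 c s hc, mul_max_of_nonneg _ _ hc]⟩

theorem comp_mem {κ : Type*} {g : (κ → ℝ) → ℝ} (hg : g ∈ PosHomog κ)
    {f : κ → (ι → ℝ) → ℝ} (hf : ∀ k, f k ∈ PosHomog ι) :
    (fun s => g (fun k => f k s)) ∈ PosHomog ι :=
  ⟨hg.1.comp (continuous_pi fun k => (hf k).1), fun c s hc => by
    have h : (fun k => f k (c • s)) = c • fun k => f k s := funext fun k => (hf k).2 c s hc
    change g (fun k => f k (c • s)) = _
    rw [h, hg.2 c _ hc]⟩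

/-- The `i`-th coordinate function. -/
def coord (i : ι) : PosHomog ι := ⟨fun s => s i, coord_mem i⟩

/-- Pointwise maximum. -/
instance : Max (PosHomog ι) := ⟨fun f g => ⟨f.1 ⊔ g.1, sup_mem f.2 g.2⟩⟩

end PosHomog

section Krivine

variable {X : Type*} [NormedAddCommGroup X] [Lattice X] [HasSolidNorm X] [IsOrderedAddMonoid X]
  [NormedSpace ℝ X] [IsOrderedModule ℝ X]

/-- `τ` is a vector lattice homomorphism from the continuous positively homogeneous functions
on `ℝ^ι` into `X` that sends the `i`-th coordinate function to `x i`.  (Linear maps that preserve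
binary suprema preserve binary infima too.) -/
structure IsKrivineHom {ι : Type*} (x : ι → X) (τ : PosHomog ι →ₗ[ℝ] X) : Prop where
  map_coord : ∀ i, τ (PosHomog.coord i) = x i
  map_sup : ∀ f g, τ (f ⊔ g) = τ f ⊔ τ g

namespace Krivine

variable {ι : Type*} [Fintype ι] (x : ι → X)

/-- The pairs `(f, z)` where `f` is a lattice-linear expression in the coordinates and `z` is the
same expression in the vectors `x i`. -/
inductive LatRel : ((ι → ℝ) → ℝ) → X → Prop
  | coord (i : ι) : LatRel (fun s => s i) (x i)
  | zero : LatRel 0 0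
  | add {f g z w} : LatRel f z → LatRel g w → LatRel (f + g) (z + w)
  | smul (c : ℝ) {f z} : LatRel f z → LatRel (c • f) (c • z)
  | sup {f g z w} : LatRel f z → LatRel g w → LatRel (f ⊔ g) (z ⊔ w)

theorem smul_sup_of_nonneg {Y : Type*} [AddCommGroup Y] [Lattice Y] [IsOrderedAddMonoid Y]
    [Module ℝ Y] [IsOrderedModule ℝ Y] {c : ℝ} (hc : 0 ≤ c) (a b : Y) :
    c • (a ⊔ b) = c • a ⊔ c • b := by
  rcases hc.eq_or_lt with rfl | hc
  · simp
  · exact (OrderIso.smulRight hc).map_sup a b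

theorem smul_inf_of_nonneg {Y : Type*} [AddCommGroup Y] [Lattice Y] [IsOrderedAddMonoid Y]
    [Module ℝ Y] [IsOrderedModule ℝ Y] {c : ℝ} (hc : 0 ≤ c) (a b : Y) :
    c • (a ⊓ b) = c • a ⊓ c • b := by
  rcases hc.eq_or_lt with rfl | hc
  · simp
  · exact (OrderIso.smulRight hc).map_inf a b

/-- The linear expressions. -/
def lin : (ι → ℝ) →ₗ[ℝ] ((ι → ℝ) → ℝ) × X where
  toFun a := (fun s => ∑ i, a i * s i, ∑ i, a i • x i)
  map_add' a b := by
    ext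
    · simp [add_mul, Finset.sum_add_distrib]
    · simp [add_smul, Finset.sum_add_distrib]
  map_smul' c a := by
    ext
    · simp [mul_assoc, Finset.mul_sum]
    · simp [Finset.smul_sum, smul_smul]

theorem add_mem_closure {u w : ((ι → ℝ) → ℝ) × X}
    (hu : u ∈ latticeClosure (Set.range (lin x))) (hw : w ∈ latticeClosure (Set.range (lin x))) :
    u + w ∈ latticeClosure (Set.range (lin x)) := by
  have hL := isSublattice_latticeClosure (s := Set.range (lin x))
  have key : ∀ a : ι → ℝ, ∀ u ∈ latticeClosure (Set.range (lin x)),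
      u + lin x a ∈ latticeClosure (Set.range (lin x)) := by
    intro a
    refine latticeClosure_min (t := {u | u + lin x a ∈ latticeClosure (Set.range (lin x))}) ?_
      ⟨?_, ?_⟩
    · rintro _ ⟨b, rfl⟩
      exact subset_latticeClosure ⟨b + a, map_add _ _ _⟩
    · intro b hb c hc
      simpa only [Set.mem_ofPred_eq, sup_add] using hL.1 hb hc
    · intro b hb c hc
      simpa only [Set.mem_ofPred_eq, inf_add] using hL.2 hb hc
  refine latticeClosure_min (t := {w | u + w ∈ latticeClosure (Set.range (lin x))}) ?_
      ⟨?_, ?_⟩ hw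
  · rintro _ ⟨b, rfl⟩
    exact key b u hu
  · intro b hb c hc
    simpa only [Set.mem_ofPred_eq, add_sup] using hL.1 hb hc
  · intro b hb c hc
    simpa only [Set.mem_ofPred_eq, add_inf] using hL.2 hb hc

theorem neg_mem_closure {u : ((ι → ℝ) → ℝ) × X}
    (hu : u ∈ latticeClosure (Set.range (lin x))) :
    -u ∈ latticeClosure (Set.range (lin x)) := by
  have hL := isSublattice_latticeClosure (s := Set.range (lin x))
  refine latticeClosure_min (t := {w | -w ∈ latticeClosure (Set.range (lin x))}) ?_
      ⟨?_, ?_⟩ hu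
  · rintro _ ⟨b, rfl⟩
    exact subset_latticeClosure ⟨-b, map_neg _ _⟩
  · intro b hb c hc
    simpa only [Set.mem_ofPred_eq, neg_sup] using hL.2 hb hc
  · intro b hb c hc
    simpa only [Set.mem_ofPred_eq, neg_inf] using hL.1 hb hc

theorem smul_mem_closure {u : ((ι → ℝ) → ℝ) × X}
    (hu : u ∈ latticeClosure (Set.range (lin x))) (c : ℝ) :
    c • u ∈ latticeClosure (Set.range (lin x)) := by
  have hL := isSublattice_latticeClosure (s := Set.range (lin x))
  have key : ∀ c : ℝ, 0 ≤ c → c • u ∈ latticeClosure (Set.range (lin x)) := by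
    intro c hc
    refine latticeClosure_min (t := {w | c • w ∈ latticeClosure (Set.range (lin x))}) ?_
      ⟨?_, ?_⟩ hu
    · rintro _ ⟨b, rfl⟩
      exact subset_latticeClosure ⟨c • b, map_smul _ _ _⟩
    · intro a ha b hb
      have := hL.1 ha hb
      rw [Set.mem_ofPred_eq]
      convert this using 1
      ext1
      · exact funext fun s => mul_max_of_nonneg _ _ hc
      · exact smul_sup_of_nonneg hc _ _
    · intro a ha b hb
      have := hL.2 ha hb
      rw [Set.mem_ofPred_eq]
      convert this using 1
      ext1
      · exact funext fun s => mul_min_of_nonneg _ _ hc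
      · exact smul_inf_of_nonneg hc _ _
  rcases le_total 0 c with hc | hc
  · exact key c hc
  · have := neg_mem_closure x (key (-c) (by linarith))
    simpa using this

theorem LatRel.mem_closure {f : (ι → ℝ) → ℝ} {z : X} (h : LatRel x f z) :
    (f, z) ∈ latticeClosure (Set.range (lin x)) := by
  classical
  induction h with
  | coord i =>
    refine subset_latticeClosure ⟨Pi.single i 1, ?_⟩
    ext
    · simp [lin, Pi.single_apply]
    · simp [lin, Pi.single_apply]
  | zero => exact subset_latticeClosure ⟨0, map_zero _⟩
  | add _ _ h1 h2 => exact add_mem_closure x h1 h2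
  | smul c _ h1 => exact smul_mem_closure x h1 c
  | sup _ _ h1 h2 => exact isSublattice_latticeClosure.1 h1 h2

/-- A finite infimum of linear expressions that is nowhere positive on `ℝ^ι` is not positive
in `X`. -/
theorem inf_nonpos {u : ((ι → ℝ) → ℝ) × X} (hu : u ∈ infClosure (Set.range (lin x)))
    (h : ∀ s, u.1 s ≤ 0) : u.2 ≤ 0 := by
  classical
  obtain ⟨t, ht, hts, rfl⟩ := hu
  choose a ha using fun w : t => hts w.2
  set A : Set (ι → ℝ) := Set.range a with hA
  have hAfin : A.Finite := Set.finite_range a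
  have h0 : (0 : ι → ℝ) ∈ convexHull ℝ A := by
    by_contra hn
    obtain ⟨φ, c, hc, hφ⟩ := geometric_hahn_banach_point_closed (convex_convexHull ℝ A)
      (hAfin.isClosed_convexHull ℝ) hn
    rw [map_zero] at hc
    have hpos : 0 < (t.inf' ht id).1 (fun i => φ (Pi.single i 1)) := by
      refine Finset.inf'_induction (p := fun w : ((ι → ℝ) → ℝ) × X =>
        0 < w.1 (fun i => φ (Pi.single i 1))) ht id ?_ ?_
      · intro w hw v hv
        exact lt_min hw hv
      · intro w hw
        have h1 := hφ (a ⟨w, hw⟩) (subset_convexHull ℝ A ⟨_, rfl⟩)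
        have h2 := ha ⟨w, hw⟩
        have h3 : φ (a ⟨w, hw⟩) = ∑ i, a ⟨w, hw⟩ i * φ (Pi.single i 1) := by
          conv_lhs => rw [← Finset.univ_sum_single (a ⟨w, hw⟩), map_sum]
          refine Finset.sum_congr rfl fun i _ => ?_
          rw [← smul_eq_mul, ← map_smul, ← Pi.single_smul, smul_eq_mul, mul_one]
        have h4 : w.1 (fun i => φ (Pi.single i 1)) = φ (a ⟨w, hw⟩) := by
          rw [h3]
          exact (congrFun (congrArg Prod.fst h2) _).symm
        simp only [id]
        rw [h4]
        linarith
    exact absurd (h _) (not_le.2 hpos)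
  have hconv : Convex ℝ {b : ι → ℝ | (t.inf' ht id).2 ≤ (lin x b).2} :=
    (convex_Ici ((t.inf' ht id).2)).linear_preimage ((LinearMap.snd ℝ _ _).comp (lin x))
  have hsub : A ⊆ {b : ι → ℝ | (t.inf' ht id).2 ≤ (lin x b).2} := by
    rintro _ ⟨w, rfl⟩
    have h1 : t.inf' ht id ≤ id w.1 := Finset.inf'_le id w.2
    rw [Set.mem_ofPred_eq, ha w]
    exact h1.2
  have := convexHull_min hsub hconv h0
  simpa using this

/-- Lattice-linear inequalities that hold in `ℝ` hold in `X`. -/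
theorem LatRel.nonpos {f : (ι → ℝ) → ℝ} {z : X} (hf : LatRel x f z) (h : ∀ s, f s ≤ 0) :
    z ≤ 0 := by
  have h1 := LatRel.mem_closure x hf
  have h2 : (f, z) ∈ supClosure (infClosure (Set.range (lin x))) := by
    let : DistribLattice X := AddCommGroup.toDistribLattice X
    rw [supClosure_infClosure]
    exact h1
  obtain ⟨t, ht, hts, hsup⟩ := h2
  have h3 : t.sup' ht id ≤ (f, 0) := by
    refine Finset.sup'_le ht id fun w hw => ?_
    have hw1 : id w ≤ t.sup' ht id := Finset.le_sup' id hw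
    rw [hsup] at hw1
    exact ⟨hw1.1, inf_nonpos x (hts hw) fun s => (hw1.1 s).trans (h s)⟩
  rw [hsup] at h3
  exact h3.2

theorem LatRel.neg {f : (ι → ℝ) → ℝ} {z : X} (hf : LatRel x f z) : LatRel x (-f) (-z) := by
  have := LatRel.smul (-1) hf
  simpa using this

theorem LatRel.sub {f g : (ι → ℝ) → ℝ} {z w : X} (hf : LatRel x f z) (hg : LatRel x g w) :
    LatRel x (f - g) (z - w) := by
  simpa [sub_eq_add_neg] using hf.add (hg.neg)

theorem LatRel.norm : LatRel x (fun s => ∑ i, |s i|) (∑ i, |x i|) := by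
  classical
  have : ∀ t : Finset ι, LatRel x (fun s => ∑ i ∈ t, |s i|) (∑ i ∈ t, |x i|) := by
    intro t
    induction t using Finset.induction_on with
    | empty =>
      simp only [Finset.sum_empty]
      exact LatRel.zero
    | insert i t hi ih =>
      simp only [Finset.sum_insert hi]
      exact ((LatRel.coord (x := x) i).sup (LatRel.coord i).neg).add ih
  exact this Finset.univ

theorem LatRel.mem_posHomog {f : (ι → ℝ) → ℝ} {z : X} (hf : LatRel x f z) : f ∈ PosHomog ι := by
  induction hf with
  | coord i => exact PosHomog.coord_mem i
  | zero => exact zero_mem _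
  | add _ _ h1 h2 => exact add_mem h1 h2
  | smul c _ h1 => exact Submodule.smul_mem _ c h1
  | sup _ _ h1 h2 => exact PosHomog.sup_mem h1 h2

theorem norm_le_of_abs_le {z e : X} {c : ℝ} (hc : 0 ≤ c) (h : |z| ≤ c • e) : ‖z‖ ≤ c * ‖e‖ := by
  have h1 : ‖z‖ ≤ ‖c • e‖ := norm_le_norm_of_abs_le_abs (h.trans (le_abs_self _))
  rwa [norm_smul, Real.norm_of_nonneg hc] at h1

theorem LatRel.norm_le {f : (ι → ℝ) → ℝ} {z : X} (hf : LatRel x f z) {c : ℝ} (hc : 0 ≤ c)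
    (h : ∀ s, |f s| ≤ c * ∑ i, |s i|) : ‖z‖ ≤ c * ‖∑ i, |x i|‖ := by
  refine norm_le_of_abs_le hc (sup_le ?_ ?_)
  · have := LatRel.nonpos x (hf.sub x ((LatRel.norm x).smul c)) fun s => by
      simpa using (le_abs_self _).trans (h s)
    exact sub_nonpos.1 this
  · have := LatRel.nonpos x ((hf.neg x).sub x ((LatRel.norm x).smul c)) fun s => by
      have := (neg_le_abs _).trans (h s)
      simp only [Pi.sub_apply, Pi.neg_apply, Pi.smul_apply, smul_eq_mul]
      linarith
    exact sub_nonpos.1 this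

/-- Lattice-linear expressions are dense. -/
theorem exists_latRel {f : (ι → ℝ) → ℝ} (hf : f ∈ PosHomog ι) {ε : ℝ} (hε : 0 < ε) :
    ∃ g z, LatRel x g z ∧ ∀ s, |f s - g s| ≤ ε * ∑ i, |s i| := by
  set S : Set (ι → ℝ) := {s | ∑ i, |s i| = 1} with hS
  have hScl : IsClosed S := isClosed_eq (by fun_prop) continuous_const
  have hSb : S ⊆ Metric.closedBall 0 1 := by
    intro s hs
    rw [mem_closedBall_zero_iff, pi_norm_le_iff_of_nonneg zero_le_one]
    intro i
    rw [← (show ∑ i, |s i| = 1 from hs), Real.norm_eq_abs]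
    exact Finset.single_le_sum (f := fun i => |s i|) (fun i _ => abs_nonneg _) (Finset.mem_univ i)
  have hSc : IsCompact S := (isCompact_closedBall _ _).of_isClosed_subset hScl hSb
  have : CompactSpace S := isCompact_iff_compactSpace.1 hSc
  let L : Set C(S, ℝ) := {h | ∃ g z, LatRel x g z ∧ ∀ s : S, h s = g s.1}
  have hmk : ∀ {g z}, LatRel x g z → ∃ h ∈ L, ∀ s : S, h s = g s.1 := fun {g z} hg =>
    ⟨⟨fun s => g s.1, (LatRel.mem_posHomog x hg).1.comp continuous_subtype_val⟩,
      ⟨g, z, hg, fun _ => rfl⟩, fun _ => rfl⟩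
  have htop : closure L = ⊤ := by
    refine ContinuousMap.sublattice_closure_eq_top L ?_ ?_ ?_ ?_
    · obtain ⟨h, hh, -⟩ := hmk (LatRel.zero (x := x))
      exact ⟨h, hh⟩
    · rintro h1 ⟨g1, z1, hg1, e1⟩ h2 ⟨g2, z2, hg2, e2⟩
      refine ⟨_, _, ((hg1.neg x).sup (hg2.neg x)).neg x, fun s => ?_⟩
      simp [e1, e2, ← neg_inf]
    · rintro h1 ⟨g1, z1, hg1, e1⟩ h2 ⟨g2, z2, hg2, e2⟩
      exact ⟨_, _, hg1.sup hg2, fun s => by simp [e1, e2]⟩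
    · intro v s t
      have hs : ∑ i, |s.1 i| = 1 := s.2
      have ht : ∑ i, |t.1 i| = 1 := t.2
      by_cases hst : s = t
      · subst hst
        obtain ⟨h, hh, e⟩ := hmk ((LatRel.norm x).smul (v s))
        exact ⟨h, hh, by simp [e, hs], by simp [e, hs]⟩
      · obtain ⟨i, hi⟩ : ∃ i, s.1 i ≠ t.1 i := by
          by_contra hcon
          push Not at hcon
          exact hst (Subtype.ext (funext hcon))
        have hd : s.1 i - t.1 i ≠ 0 := sub_ne_zero.2 hi
        obtain ⟨h, hh, e⟩ := hmk (((LatRel.norm x).smul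
          ((v t * s.1 i - v s * t.1 i) / (s.1 i - t.1 i))).add
          ((LatRel.coord (x := x) i).smul ((v s - v t) / (s.1 i - t.1 i))))
        refine ⟨h, hh, ?_, ?_⟩
        · rw [e]
          simp only [Pi.add_apply, Pi.smul_apply, smul_eq_mul, hs]
          field_simp
          ring
        · rw [e]
          simp only [Pi.add_apply, Pi.smul_apply, smul_eq_mul, ht]
          field_simp
          ring
  let F : C(S, ℝ) := ⟨fun s => f s.1, hf.1.comp continuous_subtype_val⟩
  have hF : F ∈ closure L := by rw [htop]; trivial
  obtain ⟨h, ⟨g, z, hg, e⟩, hd⟩ := Metric.mem_closure_iff.1 hF ε hε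
  refine ⟨g, z, hg, fun s => ?_⟩
  have hgh := LatRel.mem_posHomog x hg
  set N := ∑ i, |s i| with hN
  have hN0 : 0 ≤ N := Finset.sum_nonneg fun i _ => abs_nonneg _
  have hzero : ∀ k ∈ PosHomog ι, k 0 = 0 := fun k hk => by
    simpa using hk.2 0 0 le_rfl
  rcases hN0.eq_or_lt with h0 | hpos
  · have hs0 : s = 0 := by
      funext i
      have := (Finset.sum_eq_zero_iff_of_nonneg (fun i _ => abs_nonneg (s i))).1
        (hN.symm.trans h0.symm) i (Finset.mem_univ i)
      simpa using this
    rw [hs0, hzero f hf, hzero g hgh]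
    simp [← h0]
  · have hmem : N⁻¹ • s ∈ S := by
      simp only [hS, Set.mem_ofPred_eq, Pi.smul_apply, smul_eq_mul, abs_mul, ← Finset.mul_sum]
      rw [abs_of_pos (inv_pos.2 hpos), ← hN, inv_mul_cancel₀ hpos.ne']
    have h1 : dist (F ⟨_, hmem⟩) (h ⟨_, hmem⟩) < ε :=
      (ContinuousMap.dist_apply_le_dist _).trans_lt hd
    rw [e, Real.dist_eq] at h1
    change |f (N⁻¹ • s) - g (N⁻¹ • s)| < ε at h1
    rw [hf.2 _ _ (inv_pos.2 hpos).le, hgh.2 _ _ (inv_pos.2 hpos).le, ← mul_sub, abs_mul,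
      abs_of_pos (inv_pos.2 hpos), inv_mul_lt_iff₀ hpos] at h1
    linarith

/-- `z` is a limit of lattice-linear expressions in the `x i` that converge to `f`. -/
def Val (f : (ι → ℝ) → ℝ) (z : X) : Prop :=
  ∀ ε > 0, ∃ g w, LatRel x g w ∧ (∀ s, |f s - g s| ≤ ε * ∑ i, |s i|) ∧ ‖z - w‖ ≤ ε

theorem Val.unique {f : (ι → ℝ) → ℝ} {z z' : X} (h : Val x f z) (h' : Val x f z') : z = z' := by
  set e := ‖∑ i, |x i|‖ with he
  have he0 : 0 ≤ e := norm_nonneg _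
  have key : ∀ ε > 0, ‖z - z'‖ ≤ ε * (2 + 2 * e) := by
    intro ε hε
    obtain ⟨g, w, hg, hfg, hw⟩ := h ε hε
    obtain ⟨g', w', hg', hfg', hw'⟩ := h' ε hε
    have h1 := (hg.sub x hg').norm_le x (c := 2 * ε) (by positivity) fun s => by
      have h1 := hfg s
      have h2 := hfg' s
      rw [abs_le] at *
      simp only [Pi.sub_apply]
      constructor <;> linarith
    have h2 : z - z' = (z - w) + (w - w') - (z' - w') := by abel
    have h3 := norm_sub_le ((z - w) + (w - w')) (z' - w')
    have h4 := norm_add_le (z - w) (w - w')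
    rw [h2]
    linarith
  have : ‖z - z'‖ ≤ 0 := by
    refine le_of_forall_pos_le_add fun δ hδ => ?_
    have := key (δ / (2 + 2 * e)) (by positivity)
    rwa [div_mul_cancel₀ _ (by positivity), ← zero_add δ] at this
  exact sub_eq_zero.1 (norm_le_zero_iff.1 this)

theorem LatRel.val {f : (ι → ℝ) → ℝ} {z : X} (h : LatRel x f z) : Val x f z := fun ε hε =>
  ⟨f, z, h, fun s => by
    simpa using mul_nonneg hε.le (Finset.sum_nonneg fun i _ => abs_nonneg (s i)),
    by simpa using hε.le⟩

theorem Val.add {f g : (ι → ℝ) → ℝ} {z w : X} (hf : Val x f z) (hg : Val x g w) :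
    Val x (f + g) (z + w) := by
  intro ε hε
  obtain ⟨f', z', h1, h2, h3⟩ := hf (ε / 2) (by positivity)
  obtain ⟨g', w', k1, k2, k3⟩ := hg (ε / 2) (by positivity)
  refine ⟨_, _, h1.add k1, fun s => ?_, ?_⟩
  · have a1 := h2 s
    have a2 := k2 s
    rw [abs_le] at *
    simp only [Pi.add_apply]
    constructor <;> linarith
  · rw [add_sub_add_comm]
    exact (norm_add_le _ _).trans (by linarith)

theorem Val.smul {f : (ι → ℝ) → ℝ} {z : X} (hf : Val x f z) (c : ℝ) :
    Val x (c • f) (c • z) := by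
  intro ε hε
  obtain ⟨f', z', h1, h2, h3⟩ := hf (ε / (1 + |c|)) (by positivity)
  have hc : |c| * (ε / (1 + |c|)) ≤ ε := by
    rw [mul_div_assoc', div_le_iff₀ (by positivity)]
    nlinarith [abs_nonneg c]
  refine ⟨_, _, h1.smul c, fun s => ?_, ?_⟩
  · simp only [Pi.smul_apply, smul_eq_mul, ← mul_sub, abs_mul]
    calc |c| * |f s - f' s| ≤ |c| * (ε / (1 + |c|) * ∑ i, |s i|) := by gcongr; exact h2 s
      _ = (|c| * (ε / (1 + |c|))) * ∑ i, |s i| := by ring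
      _ ≤ ε * ∑ i, |s i| := by gcongr
  · rw [← smul_sub, norm_smul, Real.norm_eq_abs]
    exact (mul_le_mul_of_nonneg_left h3 (abs_nonneg c)).trans hc

theorem Val.sup {f g : (ι → ℝ) → ℝ} {z w : X} (hf : Val x f z) (hg : Val x g w) :
    Val x (f ⊔ g) (z ⊔ w) := by
  intro ε hε
  obtain ⟨f', z', h1, h2, h3⟩ := hf (ε / 2) (by positivity)
  obtain ⟨g', w', k1, k2, k3⟩ := hg (ε / 2) (by positivity)
  refine ⟨_, _, h1.sup k1, fun s => ?_, ?_⟩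
  · have a1 := h2 s
    have a2 := k2 s
    have := norm_sup_sub_sup_le_add_norm (f s) (g s) (f' s) (g' s)
    simp only [Real.norm_eq_abs] at this
    simp only [Pi.sup_apply]
    linarith
  · exact (norm_sup_sub_sup_le_add_norm _ _ _ _).trans (by linarith)

theorem exists_val [CompleteSpace X] {f : (ι → ℝ) → ℝ} (hf : f ∈ PosHomog ι) :
    ∃ z, Val x f z := by
  set e := ‖∑ i, |x i|‖ with he
  have hpos : ∀ n : ℕ, (0 : ℝ) < 1 / ((n : ℝ) + 1) := fun n => Nat.one_div_pos_of_nat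
  choose g w hg hfg using fun n : ℕ => exists_latRel x hf (hpos n)
  have hb0 : Filter.Tendsto (fun n : ℕ => 2 * (1 / ((n : ℝ) + 1)) * e) Filter.atTop (nhds 0) := by
    have := (tendsto_one_div_add_atTop_nhds_zero_nat (𝕜 := ℝ)).const_mul 2 |>.mul_const e
    simpa using this
  have hcau : CauchySeq w := by
    refine cauchySeq_of_le_tendsto_0 (fun n : ℕ => 2 * (1 / ((n : ℝ) + 1)) * e) ?_ hb0
    intro n m N hn hm
    rw [dist_eq_norm]
    refine ((hg n).sub x (hg m)).norm_le x (by positivity) fun s => ?_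
    have hs : 0 ≤ ∑ i, |s i| := Finset.sum_nonneg fun i _ => abs_nonneg _
    have h1 : |f s - g n s| ≤ 1 / ((N : ℝ) + 1) * ∑ i, |s i| :=
      (hfg n s).trans (by gcongr)
    have h2 : |f s - g m s| ≤ 1 / ((N : ℝ) + 1) * ∑ i, |s i| :=
      (hfg m s).trans (by gcongr)
    rw [abs_le] at *
    simp only [Pi.sub_apply]
    constructor <;> linarith
  obtain ⟨z, hz⟩ := cauchySeq_tendsto_of_complete hcau
  refine ⟨z, fun ε hε => ?_⟩
  have h1 : ∀ᶠ n : ℕ in Filter.atTop, 1 / ((n : ℝ) + 1) < ε :=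
    (tendsto_one_div_add_atTop_nhds_zero_nat (𝕜 := ℝ)).eventually_lt_const hε
  have h2 : ∀ᶠ n : ℕ in Filter.atTop, dist (w n) z < ε := (Metric.tendsto_nhds.1 hz) ε hε
  obtain ⟨n, hn1, hn2⟩ := (h1.and h2).exists
  refine ⟨g n, w n, hg n, fun s => (hfg n s).trans ?_, ?_⟩
  · have hs : 0 ≤ ∑ i, |s i| := Finset.sum_nonneg fun i _ => abs_nonneg _
    gcongr
  · rw [← dist_eq_norm, dist_comm]
    exact hn2.le

end Krivine

/-- Existence of Krivine's functional calculus in a Banach lattice. -/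
theorem exists_isKrivineHom [CompleteSpace X] {ι : Type*} [Fintype ι] (x : ι → X) :
    ∃ τ : PosHomog ι →ₗ[ℝ] X, IsKrivineHom x τ := by
  choose τ hτ using fun f : PosHomog ι => Krivine.exists_val x f.2
  refine ⟨⟨⟨τ, fun f g => ?_⟩, fun c f => ?_⟩, fun i => ?_, fun f g => ?_⟩
  · exact (hτ (f + g)).unique x ((hτ f).add x (hτ g))
  · exact (hτ (c • f)).unique x ((hτ f).smul x c)
  · exact (hτ (PosHomog.coord i)).unique x ((Krivine.LatRel.coord i).val x)
  · exact (hτ (f ⊔ g)).unique x ((hτ f).sup x (hτ g))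

theorem IsKrivineHom.mono {ι : Type*} {x : ι → X} {τ : PosHomog ι →ₗ[ℝ] X}
    (h : IsKrivineHom x τ) {f g : PosHomog ι} (hfg : ∀ s, f.1 s ≤ g.1 s) : τ f ≤ τ g := by
  have : f ⊔ g = g := Subtype.ext (funext fun s => max_eq_right (hfg s))
  rw [← this, h.map_sup]
  exact le_sup_left

theorem IsKrivineHom.eq_of_latRel {ι : Type*} [Fintype ι] {x : ι → X} {τ : PosHomog ι →ₗ[ℝ] X}
    (h : IsKrivineHom x τ) {f : (ι → ℝ) → ℝ} {z : X} (hf : Krivine.LatRel x f z) :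
    τ ⟨f, hf.mem_posHomog x⟩ = z := by
  induction hf with
  | coord i => exact h.map_coord i
  | zero => exact map_zero τ
  | @add f g z w h1 h2 i1 i2 =>
    have := map_add τ ⟨f, h1.mem_posHomog x⟩ ⟨g, h2.mem_posHomog x⟩
    rwa [i1, i2] at this
  | @smul c f z h1 i1 =>
    have := map_smul τ c ⟨f, h1.mem_posHomog x⟩
    rwa [i1] at this
  | @sup f g z w h1 h2 i1 i2 =>
    have := h.map_sup ⟨f, h1.mem_posHomog x⟩ ⟨g, h2.mem_posHomog x⟩
    rwa [i1, i2] at this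

theorem IsKrivineHom.val {ι : Type*} [Fintype ι] {x : ι → X} {τ : PosHomog ι →ₗ[ℝ] X}
    (h : IsKrivineHom x τ) (f : PosHomog ι) : Krivine.Val x f.1 (τ f) := by
  intro ε hε
  set e := ‖∑ i, |x i|‖ with he
  have he0 : 0 ≤ e := norm_nonneg _
  have hδ : 0 < ε / (1 + e) := by positivity
  obtain ⟨g, w, hg, hfg⟩ := Krivine.exists_latRel x f.2 hδ
  have hle : ε / (1 + e) ≤ ε := div_le_self hε.le (by linarith)
  refine ⟨g, w, hg, fun s => (hfg s).trans ?_, ?_⟩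
  · have hs : 0 ≤ ∑ i, |s i| := Finset.sum_nonneg fun i _ => abs_nonneg _
    gcongr
  · have hN := Krivine.LatRel.norm x
    have h1 := h.eq_of_latRel hg
    have h2 := h.eq_of_latRel (hN.smul (ε / (1 + e)))
    have h3 : |τ f - w| ≤ (ε / (1 + e)) • ∑ i, |x i| := by
      rw [← h2, ← h1, ← map_sub]
      refine sup_le (h.mono fun s => ?_) ?_
      · exact (le_abs_self _).trans (hfg s)
      · rw [← map_neg]
        exact h.mono fun s => (neg_le_abs _).trans (hfg s)
    refine (Krivine.norm_le_of_abs_le hδ.le h3).trans ?_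
    rw [div_mul_eq_mul_div, div_le_iff₀ (by positivity)]
    nlinarith

/-- Uniqueness of Krivine's functional calculus. -/
theorem IsKrivineHom.unique {ι : Type*} [Fintype ι] {x : ι → X} {τ τ' : PosHomog ι →ₗ[ℝ] X}
    (h : IsKrivineHom x τ) (h' : IsKrivineHom x τ') : τ = τ' :=
  LinearMap.ext fun f => (h.val f).unique x (h'.val f)

open Classical in
/-- Krivine's functional calculus: `homCalc f x` is the element `f(x₁, …, xₙ)` of the Banach
lattice `X`, that is, the image of `f` under the unique vector lattice homomorphism sending the
coordinate functions to the `x i`. (It is `0` if `f` is not continuous and positively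
homogeneous.) -/
noncomputable def homCalc [CompleteSpace X] {ι : Type*} [Fintype ι] (f : (ι → ℝ) → ℝ)
    (x : ι → X) : X :=
  if hf : f ∈ PosHomog ι then (exists_isKrivineHom x).choose ⟨f, hf⟩ else 0

section

variable [CompleteSpace X] {ι : Type*} [Fintype ι] {x : ι → X}

theorem homCalc_eq {τ : PosHomog ι →ₗ[ℝ] X} (h : IsKrivineHom x τ) {f : (ι → ℝ) → ℝ}
    (hf : f ∈ PosHomog ι) : homCalc f x = τ ⟨f, hf⟩ := by
  rw [homCalc, dif_pos hf, (exists_isKrivineHom x).choose_spec.unique h]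

theorem homCalc_coord (i : ι) : homCalc (fun s : ι → ℝ => s i) x = x i := by
  obtain ⟨τ, h⟩ := exists_isKrivineHom x
  rw [homCalc_eq h (PosHomog.coord_mem i)]
  exact h.map_coord i

theorem homCalc_zero : homCalc (0 : (ι → ℝ) → ℝ) x = 0 := by
  obtain ⟨τ, h⟩ := exists_isKrivineHom x
  rw [homCalc_eq h (zero_mem _)]
  exact map_zero τ

theorem homCalc_smul (c : ℝ) {f : (ι → ℝ) → ℝ} (hf : f ∈ PosHomog ι) :
    homCalc (c • f) x = c • homCalc f x := by
  obtain ⟨τ, h⟩ := exists_isKrivineHom x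
  rw [homCalc_eq h hf, homCalc_eq h (Submodule.smul_mem _ c hf), ← map_smul]
  rfl

theorem homCalc_mono {f g : (ι → ℝ) → ℝ} (hf : f ∈ PosHomog ι) (hg : g ∈ PosHomog ι)
    (hfg : ∀ s, f s ≤ g s) : homCalc f x ≤ homCalc g x := by
  obtain ⟨τ, h⟩ := exists_isKrivineHom x
  rw [homCalc_eq h hf, homCalc_eq h hg]
  exact h.mono hfg

theorem homCalc_comp {κ : Type*} [Fintype κ] {g : (κ → ℝ) → ℝ} (hg : g ∈ PosHomog κ)
    {f : κ → (ι → ℝ) → ℝ} (hf : ∀ k, f k ∈ PosHomog ι) :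
    homCalc g (fun k => homCalc (f k) x) = homCalc (fun s => g (fun k => f k s)) x := by
  obtain ⟨τ, h⟩ := exists_isKrivineHom x
  let σ : PosHomog κ →ₗ[ℝ] X :=
    { toFun := fun k => τ ⟨_, PosHomog.comp_mem k.2 hf⟩
      map_add' := fun a b => (map_add τ _ _).symm ▸ rfl
      map_smul' := fun c a => (map_smul τ c _).symm ▸ rfl }
  have hσ : IsKrivineHom (fun k => homCalc (f k) x) σ :=
    ⟨fun k => (homCalc_eq h (hf k)).symm, fun a b => (h.map_sup _ _).symm ▸ rfl⟩
  rw [homCalc_eq hσ hg, homCalc_eq h (PosHomog.comp_mem hg hf)]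
  rfl

end

/-- The signed power `sgn(t) |t|^p`. -/
noncomputable def signedPow (p t : ℝ) : ℝ := (SignType.sign t : ℝ) * |t| ^ p

theorem signedPow_of_nonneg {p t : ℝ} (hp : 0 < p) (ht : 0 ≤ t) : signedPow p t = t ^ p := by
  rcases ht.eq_or_lt with rfl | ht
  · simp [signedPow, Real.zero_rpow hp.ne']
  · simp [signedPow, sign_pos ht, abs_of_pos ht]

theorem signedPow_neg (p t : ℝ) : signedPow p (-t) = -signedPow p t := by
  simp [signedPow, Left.sign_neg]

theorem signedPow_mul (p a b : ℝ) : signedPow p (a * b) = signedPow p a * signedPow p b := by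
  simp only [signedPow, sign_mul, abs_mul, Real.mul_rpow (abs_nonneg a) (abs_nonneg b),
    SignType.coe_mul]
  ring

theorem signedPow_one {p : ℝ} (hp : 0 < p) : signedPow p 1 = 1 := by
  simp [signedPow_of_nonneg hp]

theorem signedPow_zero (p : ℝ) : signedPow p 0 = 0 := by simp [signedPow]

theorem abs_signedPow {p : ℝ} (hp : 0 < p) (t : ℝ) : |signedPow p t| = |t| ^ p := by
  rcases le_total 0 t with ht | ht
  · rw [signedPow_of_nonneg hp ht, abs_of_nonneg ht, abs_of_nonneg (Real.rpow_nonneg ht p)]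
  · obtain ⟨u, rfl⟩ : ∃ u, t = -u := ⟨-t, by simp⟩
    have hu : 0 ≤ u := by linarith
    rw [signedPow_neg, abs_neg, abs_neg, signedPow_of_nonneg hp hu, abs_of_nonneg hu,
      abs_of_nonneg (Real.rpow_nonneg hu p)]

theorem signedPow_signedPow {p r : ℝ} (hp : 0 < p) (hr : 0 < r) (h : p * r = 1) (t : ℝ) :
    signedPow r (signedPow p t) = t := by
  have key : ∀ u : ℝ, 0 ≤ u → signedPow r (signedPow p u) = u := fun u hu => by
    rw [signedPow_of_nonneg hp hu, signedPow_of_nonneg hr (Real.rpow_nonneg hu p),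
      ← Real.rpow_mul hu, h, Real.rpow_one]
  rcases le_total 0 t with ht | ht
  · exact key t ht
  · have := key (-t) (by linarith)
    rw [signedPow_neg, signedPow_neg] at this
    linarith

theorem continuous_signedPow {p : ℝ} (hp : 0 < p) : Continuous (signedPow p) := by
  have : signedPow p = fun t => max t 0 ^ p - max (-t) 0 ^ p := by
    funext t
    rcases le_total 0 t with ht | ht
    · simp [signedPow_of_nonneg hp ht, max_eq_left ht, max_eq_right (neg_nonpos.2 ht),
        Real.zero_rpow hp.ne']
    · obtain ⟨u, rfl⟩ : ∃ u, t = -u := ⟨-t, by simp⟩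
      have hu : 0 ≤ u := by linarith
      simp [signedPow_neg, signedPow_of_nonneg hp hu, max_eq_left hu,
        max_eq_right (neg_nonpos.2 hu), Real.zero_rpow hp.ne']
  rw [this]
  have h := Real.continuous_rpow_const hp.le
  exact (h.comp (continuous_id.max continuous_const)).sub
    (h.comp (continuous_neg.max continuous_const))

/-- The function `(∑ |sₖ|^p)^{1/p}` on `ℝ^ι`. -/
noncomputable def lpFun (p : ℝ) (ι : Type*) [Fintype ι] (s : ι → ℝ) : ℝ :=
  (∑ k, |s k| ^ p) ^ (1 / p)

theorem lpFun_mem {p : ℝ} (hp : 0 < p) (ι : Type*) [Fintype ι] : lpFun p ι ∈ PosHomog ι := by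
  refine ⟨?_, fun c s hc => ?_⟩
  · refine (Real.continuous_rpow_const (by positivity : 0 ≤ 1 / p)).comp
      (continuous_finsetSum _ fun k _ => (Real.continuous_rpow_const hp.le).comp
        (continuous_abs.comp (continuous_apply k)))
  · have hs : 0 ≤ ∑ k, |s k| ^ p := Finset.sum_nonneg fun k _ => Real.rpow_nonneg (abs_nonneg _) p
    simp only [lpFun, Pi.smul_apply, smul_eq_mul, abs_mul, abs_of_nonneg hc,
      Real.mul_rpow hc (abs_nonneg _), ← Finset.mul_sum]
    rw [Real.mul_rpow (Real.rpow_nonneg hc p) hs, ← Real.rpow_mul hc, mul_one_div_cancel hp.ne',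
      Real.rpow_one]

/-- The element `(∑ |xₖ|^p)^{1/p}` of a Banach lattice. -/
noncomputable def lpSum [CompleteSpace X] (p : ℝ) {ι : Type*} [Fintype ι] (x : ι → X) : X :=
  homCalc (lpFun p ι) x

/-- The function `(s₀^p + s₁^p)^{1/p}` on `ℝ²`, with signed powers. -/
noncomputable def powAdd (p : ℝ) (s : Fin 2 → ℝ) : ℝ :=
  signedPow (1 / p) (signedPow p (s 0) + signedPow p (s 1))

theorem powAdd_mem {p : ℝ} (hp : 0 < p) : powAdd p ∈ PosHomog (Fin 2) := by
  have hr : 0 < 1 / p := by positivity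
  refine ⟨(continuous_signedPow hr).comp
    (((continuous_signedPow hp).comp (continuous_apply 0)).add
      ((continuous_signedPow hp).comp (continuous_apply 1))), fun c s hc => ?_⟩
  simp only [powAdd, Pi.smul_apply, smul_eq_mul, signedPow_mul, ← mul_add]
  rw [signedPow_signedPow hp hr (mul_one_div_cancel hp.ne')]

end Krivine

/-- A Banach lattice `X` is `p`-convex, `1 ≤ p < ∞`, with constant `M^{(p)}(X) = 1`. -/
class IsPConvex (p : ℝ) (X : Type*) [NormedAddCommGroup X] [Lattice X] [HasSolidNorm X]
    [IsOrderedAddMonoid X] [NormedSpace ℝ X] [IsOrderedModule ℝ X] [CompleteSpace X] : Prop where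
  one_le : 1 ≤ p
  norm_lpSum_le : ∀ (n : ℕ) (x : Fin n → X), ‖lpSum p x‖ ≤ (∑ k, ‖x k‖ ^ p) ^ (1 / p)

/-- The `p`-concavification `X_p` of a `p`-convex Banach lattice `X`: it has the same elements,
but the element `root` of `X` is regarded as the `p`-th root of the element
`pow root = sgn(root) |root|^p` of `X_p`. -/
@[ext]
structure Concavification (p : ℝ) (X : Type*) where
  /-- The element `sgn(root) |root|^p` of `X_p`. -/
  pow ::
  /-- The signed `p`-th root of an element of `X_p`. -/
  root : X

theorem IsPConvex.pos (p : ℝ) (X : Type*) [NormedAddCommGroup X] [Lattice X] [HasSolidNorm X]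
    [IsOrderedAddMonoid X] [NormedSpace ℝ X] [IsOrderedModule ℝ X] [CompleteSpace X]
    [h : IsPConvex p X] : 0 < p :=
  zero_lt_one.trans_le h.one_le

namespace Concavification

variable {p : ℝ} {X : Type*} [NormedAddCommGroup X] [Lattice X] [HasSolidNorm X]
  [IsOrderedAddMonoid X] [NormedSpace ℝ X] [IsOrderedModule ℝ X] [CompleteSpace X]

/-- `x^p + y^p` is the `p`-th power of `(x^p + y^p)^{1/p}` (signed powers). -/
noncomputable instance : Add (Concavification p X) :=
  ⟨fun u v => pow (homCalc (powAdd p) ![u.root, v.root])⟩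

instance : Zero (Concavification p X) := ⟨pow 0⟩

instance : Neg (Concavification p X) := ⟨fun u => pow (-u.root)⟩

/-- `c x^p` is the `p`-th power of `c^{1/p} x` (signed powers). -/
noncomputable instance : SMul ℝ (Concavification p X) :=
  ⟨fun c u => pow (signedPow (1 / p) c • u.root)⟩

/-- `‖x^p‖ = ‖x‖^p`. -/
noncomputable instance : Norm (Concavification p X) := ⟨fun u => ‖u.root‖ ^ p⟩

/-- The order of `X_p` is that of `X`. -/
instance : Lattice (Concavification p X) where
  le u v := u.root ≤ v.root
  le_refl u := le_refl u.root
  le_trans u v w h h' := le_trans (α := X) h h'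
  le_antisymm u v h h' := Concavification.ext (le_antisymm h h')
  sup u v := pow (u.root ⊔ v.root)
  le_sup_left u v := le_sup_left (α := X)
  le_sup_right u v := le_sup_right (α := X)
  sup_le u v w h h' := sup_le (α := X) h h'
  inf u v := pow (u.root ⊓ v.root)
  inf_le_left u v := inf_le_left (α := X)
  inf_le_right u v := inf_le_right (α := X)
  le_inf u v w h h' := le_inf (α := X) h h'

theorem root_add (u v : Concavification p X) :
    (u + v).root = homCalc (powAdd p) ![u.root, v.root] := rfl

theorem root_smul (c : ℝ) (u : Concavification p X) :
    (c • u).root = signedPow (1 / p) c • u.root := rfl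

theorem root_zero : (0 : Concavification p X).root = 0 := rfl

theorem root_neg (u : Concavification p X) : (-u).root = -u.root := rfl

theorem norm_def (u : Concavification p X) : ‖u‖ = ‖u.root‖ ^ p := rfl

theorem homCalc_powAdd (hp : 0 < p) {ι : Type*} [Fintype ι] (x : ι → X) {f g : (ι → ℝ) → ℝ}
    (hf : f ∈ PosHomog ι) (hg : g ∈ PosHomog ι) :
    homCalc (powAdd p) ![homCalc f x, homCalc g x] =
      homCalc (fun s => signedPow (1 / p) (signedPow p (f s) + signedPow p (g s))) x := by
  have h := homCalc_comp (x := x) (powAdd_mem hp) (f := ![f, g])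
    (by intro k; fin_cases k <;> assumption)
  have e : (fun k => homCalc (![f, g] k) x) = ![homCalc f x, homCalc g x] := by
    funext k; fin_cases k <;> rfl
  rw [e] at h
  exact h

theorem powAdd_comp_mem (hp : 0 < p) {ι : Type*} {f g : (ι → ℝ) → ℝ}
    (hf : f ∈ PosHomog ι) (hg : g ∈ PosHomog ι) :
    (fun s => signedPow (1 / p) (signedPow p (f s) + signedPow p (g s))) ∈ PosHomog ι :=
  PosHomog.comp_mem (powAdd_mem hp) (f := ![f, g]) (by intro k; fin_cases k <;> assumption)

theorem pow_inv (hp : 0 < p) (t : ℝ) : signedPow (1 / p) (signedPow p t) = t :=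
  signedPow_signedPow hp (by positivity) (mul_one_div_cancel hp.ne') t

theorem inv_pow (hp : 0 < p) (t : ℝ) : signedPow p (signedPow (1 / p) t) = t :=
  signedPow_signedPow (by positivity) hp (one_div_mul_cancel hp.ne') t

section

variable [IsPConvex p X]

noncomputable instance : AddCommGroup (Concavification p X) where
  add_assoc u v w := by
    have hp := IsPConvex.pos p X
    apply Concavification.ext
    have h0 := homCalc_coord (x := ![u.root, v.root, w.root]) 0
    have h1 := homCalc_coord (x := ![u.root, v.root, w.root]) 1
    have h2 := homCalc_coord (x := ![u.root, v.root, w.root]) 2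
    simp only [Matrix.cons_val] at h0 h1 h2
    have m := fun i : Fin 3 => PosHomog.coord_mem i
    have e1 := homCalc_powAdd hp ![u.root, v.root, w.root] (m 0) (m 1)
    have e2 := homCalc_powAdd hp ![u.root, v.root, w.root] (m 1) (m 2)
    have e3 := homCalc_powAdd hp ![u.root, v.root, w.root] (powAdd_comp_mem hp (m 0) (m 1)) (m 2)
    have e4 := homCalc_powAdd hp ![u.root, v.root, w.root] (m 0) (powAdd_comp_mem hp (m 1) (m 2))
    rw [← e1, h0, h1, h2] at e3
    rw [← e2, h0, h1, h2] at e4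
    simp only [root_add]
    rw [e3, e4]
    simp only [inv_pow hp, add_assoc]
  zero_add u := by
    have hp := IsPConvex.pos p X
    apply Concavification.ext
    have h0 := homCalc_coord (x := ![u.root]) 0
    simp only [Matrix.cons_val] at h0
    have e := homCalc_powAdd hp ![u.root] (zero_mem _) (PosHomog.coord_mem 0)
    rw [h0, homCalc_zero] at e
    rw [root_add, root_zero, e]
    simp only [Pi.zero_apply, signedPow_zero, zero_add, pow_inv hp]
    exact h0
  add_zero u := by
    have hp := IsPConvex.pos p X
    apply Concavification.ext
    have h0 := homCalc_coord (x := ![u.root]) 0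
    simp only [Matrix.cons_val] at h0
    have e := homCalc_powAdd hp ![u.root] (PosHomog.coord_mem 0) (zero_mem _)
    rw [h0, homCalc_zero] at e
    rw [root_add, root_zero, e]
    simp only [Pi.zero_apply, signedPow_zero, add_zero, pow_inv hp]
    exact h0
  neg_add_cancel u := by
    have hp := IsPConvex.pos p X
    apply Concavification.ext
    have h0 := homCalc_coord (x := ![u.root]) 0
    simp only [Matrix.cons_val] at h0
    have m := PosHomog.coord_mem (0 : Fin 1)
    have e := homCalc_powAdd hp ![u.root] (Submodule.smul_mem _ (-1) m) m
    rw [homCalc_smul _ m, h0, neg_one_smul] at e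
    rw [root_add, root_neg, root_zero, e]
    simp only [Pi.smul_apply, smul_eq_mul, neg_one_mul, signedPow_neg, neg_add_cancel,
      signedPow_zero]
    exact homCalc_zero
  add_comm u v := by
    have hp := IsPConvex.pos p X
    apply Concavification.ext
    have h0 := homCalc_coord (x := ![u.root, v.root]) 0
    have h1 := homCalc_coord (x := ![u.root, v.root]) 1
    simp only [Matrix.cons_val] at h0 h1
    have m := fun i : Fin 2 => PosHomog.coord_mem i
    have e1 := homCalc_powAdd hp ![u.root, v.root] (m 0) (m 1)
    have e2 := homCalc_powAdd hp ![u.root, v.root] (m 1) (m 0)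
    rw [h0, h1] at e1 e2
    rw [root_add, root_add, e1, e2]
    simp only [add_comm]
  nsmul := nsmulRec
  zsmul := zsmulRec

noncomputable instance : Module ℝ (Concavification p X) where
  one_smul u := by
    apply Concavification.ext
    rw [root_smul, signedPow_one (by have := IsPConvex.pos p X; positivity), one_smul]
  mul_smul a b u := by
    apply Concavification.ext
    simp only [root_smul, signedPow_mul, mul_smul]
  smul_zero a := by
    apply Concavification.ext
    rw [root_smul, root_zero, smul_zero]
  zero_smul u := by
    apply Concavification.ext
    rw [root_smul, root_zero, signedPow_zero, zero_smul]
  smul_add a u v := by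
    have hp := IsPConvex.pos p X
    apply Concavification.ext
    have h0 := homCalc_coord (x := ![u.root, v.root]) 0
    have h1 := homCalc_coord (x := ![u.root, v.root]) 1
    simp only [Matrix.cons_val] at h0 h1
    have m := fun i : Fin 2 => PosHomog.coord_mem i
    have e1 := homCalc_powAdd hp ![u.root, v.root] (m 0) (m 1)
    have e2 := homCalc_powAdd hp ![u.root, v.root]
      (Submodule.smul_mem _ (signedPow (1 / p) a) (m 0))
      (Submodule.smul_mem _ (signedPow (1 / p) a) (m 1))
    rw [h0, h1] at e1
    rw [homCalc_smul _ (m 0), homCalc_smul _ (m 1), h0, h1] at e2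
    simp only [root_smul, root_add]
    rw [e1, e2, ← homCalc_smul _ (powAdd_comp_mem hp (m 0) (m 1))]
    congr 1
    funext s
    simp only [Pi.smul_apply, smul_eq_mul, signedPow_mul, inv_pow hp, ← mul_add]
  add_smul a b u := by
    have hp := IsPConvex.pos p X
    apply Concavification.ext
    have h0 := homCalc_coord (x := ![u.root]) 0
    simp only [Matrix.cons_val] at h0
    have m := PosHomog.coord_mem (0 : Fin 1)
    have e2 := homCalc_powAdd hp ![u.root]
      (Submodule.smul_mem _ (signedPow (1 / p) a) m)
      (Submodule.smul_mem _ (signedPow (1 / p) b) m)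
    rw [homCalc_smul _ m, homCalc_smul _ m, h0] at e2
    simp only [root_smul, root_add]
    rw [e2]
    conv_lhs => rw [← h0, ← homCalc_smul _ m]
    congr 1
    funext s
    simp only [Pi.smul_apply, smul_eq_mul, signedPow_mul, inv_pow hp, ← add_mul, pow_inv hp]

theorem norm_core : NormedSpace.Core ℝ (Concavification p X) where
  norm_nonneg u := Real.rpow_nonneg (norm_nonneg _) p
  norm_smul c u := by
    have hp := IsPConvex.pos p X
    rw [norm_def, root_smul, norm_smul, Real.norm_eq_abs, abs_signedPow (by positivity),
      Real.mul_rpow (by positivity) (norm_nonneg _), ← Real.rpow_mul (abs_nonneg c),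
      one_div_mul_cancel hp.ne', Real.rpow_one, norm_def, Real.norm_eq_abs]
  norm_triangle u v := by
    have hp := IsPConvex.pos p X
    have hr : 0 < 1 / p := by positivity
    have hfn : ∀ s : Fin 2 → ℝ, |powAdd p s| ≤ lpFun p (Fin 2) s := fun s => by
      rw [powAdd, abs_signedPow hr, lpFun, Fin.sum_univ_two, ← abs_signedPow hp,
        ← abs_signedPow hp]
      exact Real.rpow_le_rpow (abs_nonneg _) (abs_add_le _ _) hr.le
    have habs : |homCalc (powAdd p) ![u.root, v.root]| ≤ lpSum p ![u.root, v.root] := by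
      refine sup_le (homCalc_mono (powAdd_mem hp) (lpFun_mem hp _)
        fun s => (le_abs_self _).trans (hfn s)) ?_
      have h := homCalc_smul (x := ![u.root, v.root]) (-1) (powAdd_mem hp)
      rw [neg_one_smul ℝ (homCalc _ _)] at h
      rw [← h]
      exact homCalc_mono (Submodule.smul_mem _ _ (powAdd_mem hp)) (lpFun_mem hp _)
        fun s => by simpa using (neg_le_abs _).trans (hfn s)
    have h1 : ‖(u + v).root‖ ≤ (‖u.root‖ ^ p + ‖v.root‖ ^ p) ^ (1 / p) := by
      have h2 := IsPConvex.norm_lpSum_le (p := p) 2 ![u.root, v.root]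
      rw [Fin.sum_univ_two] at h2
      exact (norm_le_norm_of_abs_le_abs (habs.trans (le_abs_self _))).trans h2
    have h3 : 0 ≤ ‖u.root‖ ^ p + ‖v.root‖ ^ p := by positivity
    have h4 := Real.rpow_le_rpow (norm_nonneg _) h1 hp.le
    rwa [← Real.rpow_mul h3, one_div_mul_cancel hp.ne', Real.rpow_one] at h4
  norm_eq_zero_iff u := by
    have hp := IsPConvex.pos p X
    rw [norm_def, Real.rpow_eq_zero (norm_nonneg _) hp.ne', norm_eq_zero]
    exact ⟨fun h => Concavification.ext h, fun h => congrArg root h⟩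

noncomputable instance : NormedAddCommGroup (Concavification p X) :=
  NormedAddCommGroup.ofCore norm_core

noncomputable instance : NormedSpace ℝ (Concavification p X) :=
  NormedSpace.ofCore norm_core

end

end Concavification

/-- The positive part `B⁺` of the closed unit ball of the dual of `X_p`, with the weak* topology
and its Borel σ-algebra. -/
def PosDualBall (p : ℝ) (X : Type*) [NormedAddCommGroup X] [Lattice X] [HasSolidNorm X]
    [IsOrderedAddMonoid X] [NormedSpace ℝ X] [IsOrderedModule ℝ X] [CompleteSpace X]
    [IsPConvex p X] : Type _ :=
  {φ : WeakDual ℝ (Concavification p X) //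
    ‖WeakDual.toStrongDual φ‖ ≤ 1 ∧ ∀ u : Concavification p X, 0 ≤ u → 0 ≤ φ u}

section PosDualBall

variable {p : ℝ} {X : Type*} [NormedAddCommGroup X] [Lattice X] [HasSolidNorm X]
  [IsOrderedAddMonoid X] [NormedSpace ℝ X] [IsOrderedModule ℝ X] [CompleteSpace X]
  [IsPConvex p X]

noncomputable instance : TopologicalSpace (PosDualBall p X) := instTopologicalSpaceSubtype

noncomputable instance : MeasurableSpace (PosDualBall p X) := borel _

instance : BorelSpace (PosDualBall p X) := ⟨rfl⟩

end PosDualBall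

/-- The exponent `r ∈ (1, ∞]` with `1/r = 1/p - 1/q`, for `1 ≤ p ≤ q < ∞`. -/
noncomputable def gapExponent (p q : ℝ) : ℝ≥0∞ := (ENNReal.ofReal (1 / p - 1 / q))⁻¹

/-- `sup ‖(∑ₖ |βₖ xₖ|^p)^{1/p}‖` over all `(βₖ)` in the closed unit ball of `ℓ_r^n`, where
`1/r = 1/p - 1/q`. -/
noncomputable def strongNorm {X : Type*} [NormedAddCommGroup X] [Lattice X] [HasSolidNorm X]
    [IsOrderedAddMonoid X] [NormedSpace ℝ X] [IsOrderedModule ℝ X] [CompleteSpace X]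
    (p q : ℝ) {n : ℕ} (x : Fin n → X) : ℝ :=
  ⨆ β : {β : PiLp (gapExponent p q) (fun _ : Fin n => ℝ) // ‖β‖ ≤ 1},
    ‖lpSum p (fun k => β.1 k • x k)‖

/-- `T` is `(p₁, …, pₘ)`-strongly `(q₁, …, qₘ)`-concave; `Q` is the exponent on the left-hand
side, which is given by `1/Q = 1/q₁ + ⋯ + 1/qₘ`. -/
def IsStronglyConcave {m : ℕ} {X : Fin m → Type*} [∀ j, NormedAddCommGroup (X j)]
    [∀ j, Lattice (X j)] [∀ j, HasSolidNorm (X j)] [∀ j, IsOrderedAddMonoid (X j)]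
    [∀ j, NormedSpace ℝ (X j)] [∀ j, IsOrderedModule ℝ (X j)] [∀ j, CompleteSpace (X j)]
    {E : Type*} [NormedAddCommGroup E] [NormedSpace ℝ E]
    (p q : Fin m → ℝ) (Q : ℝ) (T : MultilinearMap ℝ X E) : Prop :=
  ∃ C > 0, ∀ (n : ℕ) (x : ∀ j, Fin n → X j),
    (∑ k, ‖T (fun j => x j k)‖ ^ Q) ^ (1 / Q) ≤ C * ∏ j, strongNorm (p j) (q j) (x j)

/-! Everything rests on a dual formula for the right-hand side of strong concavity: `strongNorm p q
x ^ q` is the maximum over `φ ∈ B⁺` of `∑ₖ ⟨|xₖ|^p, φ⟩^{q/p}`. In the concavification the `p`-th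
power of `(∑ |βₖ xₖ|^p)^{1/p}` is the linear combination `∑ |βₖ|^p |xₖ|^p` (`sum_pow_abs`). The norm
of this positive element is attained at a positive functional, and the supremum over `β` is then
scalar Hölder duality for the exponents `q/p` and `r/p`. Weak* compactness makes the maximum
attained. The two inequalities are `exists_strongNorm_rpow_le` and
`sum_apply_rpow_le_strongNorm_rpow`.

From (ii) to (i): raise to the power `Q`, sum over `k`, apply Hölder with the weights `Q/qⱼ` (which
add up to 1), and bound each integral by the maximum.

From (i) to (ii): the inequality between weighted geometric and arithmetic means weakens the product
to a sum, so that strong concavity says that every finite sum of the functions `dominationGap` is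
nonnegative somewhere on `∏ⱼ Bⱼ⁺`. By homogeneity these sums form a convex cone. Separating it from
the strictly negative functions gives a state on `C(∏ⱼ Bⱼ⁺)`, whose marginals are the measures `νⱼ`.
The resulting bound by a sum becomes a bound by a product on replacing `xⱼ` by `tⱼ^{1/qⱼ} xⱼ` and
optimising over `t`, so nothing is lost in the constant. -/

/-! ### Suprema and absolute values in the functional calculus. -/

section HomCalc

variable {X : Type*} [NormedAddCommGroup X] [Lattice X] [HasSolidNorm X] [IsOrderedAddMonoid X]
  [NormedSpace ℝ X] [IsOrderedModule ℝ X] [CompleteSpace X] {ι : Type*} [Fintype ι] {x : ι → X}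

theorem homCalc_sup {f g : (ι → ℝ) → ℝ} (hf : f ∈ PosHomog ι) (hg : g ∈ PosHomog ι) :
    homCalc (f ⊔ g) x = homCalc f x ⊔ homCalc g x := by
  obtain ⟨τ, h⟩ := exists_isKrivineHom x
  rw [homCalc_eq h hf, homCalc_eq h hg, homCalc_eq h (PosHomog.sup_mem hf hg), ← h.map_sup]
  rfl

theorem PosHomog.abs_coord_mem (i : ι) : (fun s : ι → ℝ => |s i|) ∈ PosHomog ι :=
  PosHomog.sup_mem (coord_mem i) (neg_mem (coord_mem i))

theorem homCalc_abs_coord (i : ι) : homCalc (fun s : ι → ℝ => |s i|) x = |x i| := by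
  have m := PosHomog.coord_mem (ι := ι) i
  have h := homCalc_sup (x := x) m (Submodule.smul_mem _ (-1) m)
  rw [homCalc_smul _ m, homCalc_coord, neg_one_smul ℝ (x i)] at h
  rw [← show x i ⊔ -x i = |x i| from rfl, ← h]
  congr 1
  funext s
  simp [abs]

end HomCalc

/-! ### Order structure of the concavification and norming positive functionals. -/

namespace Concavification

variable {p : ℝ} {X : Type*} [NormedAddCommGroup X] [Lattice X] [HasSolidNorm X]
  [IsOrderedAddMonoid X] [NormedSpace ℝ X] [IsOrderedModule ℝ X] [CompleteSpace X]
  [IsPConvex p X]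

/-- Addition in `X_p` is the `ℓ_p` sum of roots, so passing to `p`-th powers turns `lpSum` into an
honest sum, to which linear functionals apply. -/
theorem sum_pow_abs {ι : Type*} [Fintype ι] (x : ι → X) :
    ∑ k, (pow |x k| : Concavification p X) = pow (lpSum p x) := by
  classical
  have hp := IsPConvex.pos p X
  have hr : 0 < 1 / p := by positivity
  -- Membership in `PosHomog` is part of the induction because composing with `powAdd` requires it
  -- at each step.
  have key : ∀ t : Finset ι, (fun s : ι → ℝ => (∑ k ∈ t, |s k| ^ p) ^ (1 / p)) ∈ PosHomog ι ∧
      ∑ k ∈ t, (pow |x k| : Concavification p X) =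
        pow (homCalc (fun s : ι → ℝ => (∑ k ∈ t, |s k| ^ p) ^ (1 / p)) x) := by
    intro t
    induction t using Finset.induction_on with
    | empty =>
      have : (fun s : ι → ℝ => (∑ k ∈ (∅ : Finset ι), |s k| ^ p) ^ (1 / p)) = 0 := by
        funext s
        simp [Real.zero_rpow (inv_ne_zero hp.ne')]
      rw [this, homCalc_zero]
      exact ⟨zero_mem _, rfl⟩
    | insert i t hi ih =>
      have m := PosHomog.abs_coord_mem (ι := ι) i
      have e := homCalc_powAdd hp x m ih.1
      have h0 := powAdd_comp_mem hp m ih.1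
      have e' : (fun s : ι → ℝ => signedPow (1 / p) (signedPow p |s i| +
          signedPow p ((∑ k ∈ t, |s k| ^ p) ^ (1 / p)))) =
          fun s : ι → ℝ => (∑ k ∈ insert i t, |s k| ^ p) ^ (1 / p) := by
        funext s
        have hs : 0 ≤ ∑ k ∈ t, |s k| ^ p := by positivity
        rw [← signedPow_of_nonneg hr hs, inv_pow hp, Finset.sum_insert hi,
          signedPow_of_nonneg hp (abs_nonneg _), signedPow_of_nonneg hr (by positivity)]
      rw [e'] at h0 e
      refine ⟨h0, ?_⟩
      rw [Finset.sum_insert hi, ih.2]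
      apply Concavification.ext
      rw [root_add, ← e, homCalc_abs_coord]
  exact (key Finset.univ).2

theorem rpow_smul_pow {c : ℝ} (hc : 0 ≤ c) (x : X) :
    (c ^ p) • (pow x : Concavification p X) = pow (c • x) := by
  have hp := IsPConvex.pos p X
  apply Concavification.ext
  rw [root_smul, ← signedPow_of_nonneg hp hc, pow_inv hp]

theorem abs_smul_eq (c : ℝ) (x : X) : |c • x| = |c| • |x| := by
  have key : ∀ c : ℝ, 0 ≤ c → |c • x| = c • |x| := fun c hc => by
    simp only [abs, Krivine.smul_sup_of_nonneg hc, smul_neg]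
  rcases le_total 0 c with hc | hc
  · rw [key c hc, abs_of_nonneg hc]
  · rw [← abs_neg (c • x), ← neg_smul, key _ (neg_nonneg.2 hc), abs_of_nonpos hc]

theorem rpow_abs_smul_pow_abs (c : ℝ) (x : X) :
    (|c| ^ p) • (pow |x| : Concavification p X) = pow |c • x| := by
  rw [rpow_smul_pow (abs_nonneg c), abs_smul_eq]

/-- The functional calculus preserves inequalities between functions, but `u ≤ v` is not one.
Writing `v` as `u ⊔ v` makes it one: `s 0 ≤ max (s 0) (s 1)` holds at every point, and signed powers
are increasing. -/
theorem add_le_add_right' {u v : Concavification p X} (h : u ≤ v) (w : Concavification p X) :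
    u + w ≤ v + w := by
  have hp := IsPConvex.pos p X
  have h0 := homCalc_coord (x := ![u.root, v.root, w.root]) 0
  have h1 := homCalc_coord (x := ![u.root, v.root, w.root]) 1
  have h2 := homCalc_coord (x := ![u.root, v.root, w.root]) 2
  simp only [Matrix.cons_val] at h0 h1 h2
  have m := fun i : Fin 3 => PosHomog.coord_mem i
  have m' := PosHomog.sup_mem (m 0) (m 1)
  have e := homCalc_sup (x := ![u.root, v.root, w.root]) (m 0) (m 1)
  have h' : u.root ≤ v.root := h
  rw [h0, h1, sup_eq_right.2 h'] at e
  have e1 := homCalc_powAdd hp ![u.root, v.root, w.root] (m 0) (m 2)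
  have e2 := homCalc_powAdd hp ![u.root, v.root, w.root] m' (m 2)
  rw [h0, h2] at e1
  rw [e, h2] at e2
  change (u + w).root ≤ (v + w).root
  rw [root_add, root_add, e1, e2]
  refine homCalc_mono (powAdd_comp_mem hp (m 0) (m 2)) (powAdd_comp_mem hp m' (m 2)) fun s => ?_
  have hmono : ∀ {r : ℝ}, 0 < r → Monotone (signedPow r) := fun {r} hr a b hab => by
    rcases le_total 0 a with ha | ha
    · rw [signedPow_of_nonneg hr ha, signedPow_of_nonneg hr (ha.trans hab)]
      exact Real.rpow_le_rpow ha hab hr.le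
    · have ea : signedPow r a = -(-a) ^ r := by
        rw [← signedPow_of_nonneg hr (neg_nonneg.2 ha), signedPow_neg, neg_neg]
      rcases le_total 0 b with hb | hb
      · rw [ea, signedPow_of_nonneg hr hb]
        have := Real.rpow_nonneg hb r
        have := Real.rpow_nonneg (neg_nonneg.2 ha) r
        linarith
      · have eb : signedPow r b = -(-b) ^ r := by
          rw [← signedPow_of_nonneg hr (neg_nonneg.2 hb), signedPow_neg, neg_neg]
        rw [ea, eb]
        exact neg_le_neg (Real.rpow_le_rpow (neg_nonneg.2 hb) (neg_le_neg hab) hr.le)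
  refine hmono (by positivity) (add_le_add_left (hmono hp ?_) _)
  exact le_sup_left

instance : IsOrderedAddMonoid (Concavification p X) where
  add_le_add_left _ _ h w := by simpa only [add_comm w] using add_le_add_right' h w

theorem norm_mono {u v : Concavification p X} (hu : 0 ≤ u) (h : u ≤ v) : ‖u‖ ≤ ‖v‖ := by
  have hp := IsPConvex.pos p X
  have hu' : (0 : X) ≤ u.root := hu
  have h' : u.root ≤ v.root := h
  refine Real.rpow_le_rpow (norm_nonneg _) (norm_le_norm_of_abs_le_abs ?_) hp.le
  rwa [abs_of_nonneg hu', abs_of_nonneg (hu'.trans h')]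

theorem smul_sup_zero {c : ℝ} (hc : 0 ≤ c) (v : Concavification p X) :
    c • v ⊔ 0 = c • (v ⊔ 0) := by
  have hp := IsPConvex.pos p X
  have hc' : 0 ≤ signedPow (1 / p) c := by
    rw [signedPow_of_nonneg (by positivity) hc]
    positivity
  apply Concavification.ext
  change signedPow (1 / p) c • v.root ⊔ 0 = signedPow (1 / p) c • (v.root ⊔ 0)
  rw [Krivine.smul_sup_of_nonneg hc', smul_zero]

/-- Every positive element of `X_p` is normed by a positive functional of norm at most one. -/
theorem exists_posDualBall_eq_norm {u : Concavification p X} (hu : 0 ≤ u) :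
    ∃ φ : PosDualBall p X, φ.1 u = ‖u‖ := by
  rcases eq_or_ne u 0 with rfl | hne
  · exact ⟨⟨0, by simp, fun _ _ => le_rfl⟩, by simp⟩
  -- Hahn–Banach with the sublinear functional `‖v⁺‖` in place of `‖v‖`: it still equals the norm at
  -- `u ≥ 0`, and it vanishes at `-v` for `v ≥ 0`, which forces the extension to be positive.
  let N : Concavification p X → ℝ := fun v => ‖v ⊔ 0‖
  have N_le : ∀ v, N v ≤ ‖v‖ := fun v => by
    have hp := IsPConvex.pos p X
    refine Real.rpow_le_rpow (norm_nonneg _) (norm_le_norm_of_abs_le_abs ?_) hp.le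
    change |v.root ⊔ 0| ≤ |v.root|
    rw [abs_of_nonneg le_sup_right]
    exact sup_le (le_abs_self _) (abs_nonneg _)
  obtain ⟨g, hg, hgN⟩ := exists_extension_of_le_sublinear
    (LinearPMap.mkSpanSingleton (σ := RingHom.id ℝ) u ‖u‖ hne) N
    (fun c hc v => by
      change ‖c • v ⊔ 0‖ = c * ‖v ⊔ 0‖
      rw [smul_sup_zero hc.le, norm_smul, Real.norm_of_nonneg hc.le])
    (fun v w => by
      refine (norm_mono le_sup_right (sup_le (add_le_add le_sup_left le_sup_left) ?_)).trans
        (norm_add_le _ _)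
      exact add_nonneg le_sup_right le_sup_right)
    (by
      rintro ⟨v, hv⟩
      obtain ⟨c, rfl⟩ := Submodule.mem_span_singleton.1 hv
      refine (LinearPMap.mkSpanSingleton'_apply u ‖u‖ _ c hv).trans_le ?_
      change c * ‖u‖ ≤ ‖c • u ⊔ 0‖
      rcases le_total 0 c with hc | hc
      · rw [smul_sup_zero hc, sup_eq_left.2 hu, norm_smul, Real.norm_of_nonneg hc]
      · exact (mul_nonpos_of_nonpos_of_nonneg hc (norm_nonneg _)).trans (norm_nonneg _))
  have hgu : g u = ‖u‖ := by
    have := hg ⟨u, Submodule.mem_span_singleton_self u⟩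
    rw [this]
    exact LinearPMap.mkSpanSingleton_apply ℝ ℝ hne _
  have hgb : ∀ v, ‖g v‖ ≤ 1 * ‖v‖ := fun v => by
    rw [one_mul, Real.norm_eq_abs, abs_le]
    refine ⟨?_, (hgN v).trans (N_le v)⟩
    have := (hgN (-v)).trans (N_le (-v))
    rw [map_neg, norm_neg] at this
    linarith
  let φ : StrongDual ℝ (Concavification p X) := g.mkContinuous 1 hgb
  refine ⟨⟨StrongDual.toWeakDual φ, ?_, fun v hv => ?_⟩, hgu⟩
  · exact g.mkContinuous_norm_le zero_le_one hgb
  · have h1 : N (-v) = 0 := by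
      change ‖-v ⊔ 0‖ = 0
      rw [sup_eq_right.2 (neg_nonpos.2 hv), norm_zero]
    have h2 := hgN (-v)
    rw [h1, map_neg] at h2
    exact neg_nonpos.1 h2

end Concavification

/-! ### Weak* compactness of the positive dual ball and evaluation on powers. -/

namespace PosDualBall

variable {p : ℝ} {X : Type*} [NormedAddCommGroup X] [Lattice X] [HasSolidNorm X]
  [IsOrderedAddMonoid X] [NormedSpace ℝ X] [IsOrderedModule ℝ X] [CompleteSpace X]
  [IsPConvex p X]

theorem continuous_apply (u : Concavification p X) :
    Continuous fun φ : PosDualBall p X => φ.1 u :=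
  (WeakDual.eval_continuous u).comp continuous_subtype_val

instance : T2Space (PosDualBall p X) :=
  inferInstanceAs (T2Space {φ : WeakDual ℝ (Concavification p X) //
    ‖WeakDual.toStrongDual φ‖ ≤ 1 ∧ ∀ u : Concavification p X, 0 ≤ u → 0 ≤ φ u})

instance : Nonempty (PosDualBall p X) := ⟨⟨0, by simp, fun _ _ => le_rfl⟩⟩

/-- Banach–Alaoglu, as positivity is a weak* closed condition. -/
instance : CompactSpace (PosDualBall p X) := by
  have h1 := WeakDual.isCompact_closedBall (𝕜 := ℝ) (E := Concavification p X) 0 1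
  have h2 : IsClosed {φ : WeakDual ℝ (Concavification p X) |
      ∀ u : Concavification p X, 0 ≤ u → 0 ≤ φ u} := by
    simp only [Set.ofPred_forall]
    exact isClosed_iInter fun u => isClosed_iInter fun _ =>
      isClosed_le continuous_const (WeakDual.eval_continuous u)
  have h3 : IsCompact {φ : WeakDual ℝ (Concavification p X) |
      ‖WeakDual.toStrongDual φ‖ ≤ 1 ∧ ∀ u : Concavification p X, 0 ≤ u → 0 ≤ φ u} := by
    convert h1.inter_right h2 using 1
    ext φ
    simp
  exact isCompact_iff_compactSpace.1 h3

theorem apply_le_norm (φ : PosDualBall p X) (u : Concavification p X) : φ.1 u ≤ ‖u‖ := by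
  have h := (WeakDual.toStrongDual φ.1).le_of_opNorm_le φ.2.1 u
  rw [one_mul] at h
  exact (le_abs_self _).trans h

theorem apply_pow_abs_nonneg (φ : PosDualBall p X) (x : X) :
    0 ≤ φ.1 (Concavification.pow |x|) :=
  φ.2.2 _ (abs_nonneg x)

theorem apply_pow_abs_smul (φ : PosDualBall p X) (c : ℝ) (x : X) :
    φ.1 (Concavification.pow |c • x|) = |c| ^ p * φ.1 (Concavification.pow |x|) := by
  rw [← Concavification.rpow_abs_smul_pow_abs, map_smul, smul_eq_mul]

theorem apply_pow_lpSum (φ : PosDualBall p X) {ι : Type*} [Fintype ι] (β : ι → ℝ) (x : ι → X) :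
    φ.1 (Concavification.pow (lpSum p fun k => β k • x k)) =
      ∑ k, |β k| ^ p * φ.1 (Concavification.pow |x k|) := by
  rw [← Concavification.sum_pow_abs, map_sum]
  exact Finset.sum_congr rfl fun k _ => φ.apply_pow_abs_smul _ _

end PosDualBall

/-! ### Hölder duality between `ℓ_{q/p}` and the `p`-th powers of the unit ball of `ℓ_r`; `p = q`
means `r = ∞`. -/

section GapExponent

variable {p q : ℝ} {n : ℕ}

theorem gapExponent_self (p : ℝ) : gapExponent p p = ∞ := by simp [gapExponent]

theorem gapExponent_toReal (hp : 0 < p) (hpq : p < q) :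
    (gapExponent p q).toReal = (1 / p - 1 / q)⁻¹ := by
  have : 0 < 1 / p - 1 / q := sub_pos.2 (one_div_lt_one_div_of_lt hp hpq)
  rw [gapExponent, ENNReal.toReal_inv, ENNReal.toReal_ofReal this.le]

theorem norm_toLp_le_one_iff_of_lt (hp : 0 < p) (hpq : p < q) (β : Fin n → ℝ) :
    ‖WithLp.toLp (gapExponent p q) β‖ ≤ 1 ↔ ∑ k, |β k| ^ (1 / p - 1 / q)⁻¹ ≤ 1 := by
  have hr : 0 < (1 / p - 1 / q)⁻¹ := inv_pos.2 (sub_pos.2 (one_div_lt_one_div_of_lt hp hpq))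
  have h := gapExponent_toReal hp hpq
  rw [PiLp.norm_eq_sum (by rwa [h]), h]
  simp only [Real.norm_eq_abs]
  have h0 : 0 ≤ ∑ k, |β k| ^ (1 / p - 1 / q)⁻¹ := by positivity
  have h1 := Real.rpow_le_rpow_iff h0 zero_le_one (one_div_pos.2 hr)
  rwa [Real.one_rpow] at h1

theorem norm_toLp_le_one_iff_self (p : ℝ) (β : Fin n → ℝ) :
    ‖WithLp.toLp (gapExponent p p) β‖ ≤ 1 ↔ ∀ k, |β k| ≤ 1 := by
  rw [gapExponent_self, PiLp.norm_eq_ciSup]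
  simp only [Real.norm_eq_abs]
  refine ⟨fun h k => (le_ciSup (Set.finite_range _).bddAbove k).trans h, fun h => ?_⟩
  exact Real.iSup_le h zero_le_one

/-- Hölder's inequality for the exponents `q / p` and `r / p`, where `1/r = 1/p - 1/q`. -/
theorem sum_abs_rpow_mul_le (hp : 0 < p) (hpq : p ≤ q) {β t : Fin n → ℝ}
    (hβ : ‖WithLp.toLp (gapExponent p q) β‖ ≤ 1) (ht : ∀ k, 0 ≤ t k) :
    ∑ k, |β k| ^ p * t k ≤ (∑ k, t k ^ (q / p)) ^ (p / q) := by
  rcases hpq.eq_or_lt with rfl | hlt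
  · rw [norm_toLp_le_one_iff_self] at hβ
    simp only [div_self hp.ne', Real.rpow_one]
    exact Finset.sum_le_sum fun k _ =>
      mul_le_of_le_one_left (ht k) (Real.rpow_le_one (abs_nonneg _) (hβ k) hp.le)
  · rw [norm_toLp_le_one_iff_of_lt hp hlt] at hβ
    have hq : 0 < q := hp.trans hlt
    have hd : 0 < 1 / p - 1 / q := sub_pos.2 (one_div_lt_one_div_of_lt hp hlt)
    -- With `1/r = 1/p - 1/q`, the exponents `r/p` and `q/p` are conjugate since `p/r + p/q = 1`;
    -- the factor with `β` is at most 1 because `(|βₖ|^p)^{r/p} = |βₖ|^r`.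
    have hc : Real.HolderConjugate ((1 / p - 1 / q)⁻¹ / p) (q / p) := by
      refine Real.HolderConjugate.symm ((Real.holderConjugate_iff).2 ⟨(one_lt_div hp).2 hlt, ?_⟩)
      field_simp
      ring
    have h := Real.inner_le_Lp_mul_Lq_of_nonneg Finset.univ hc (f := fun k => |β k| ^ p) (g := t)
      (fun k _ => by positivity) (fun k _ => ht k)
    refine h.trans ?_
    have h0 : 0 ≤ ∑ k, t k ^ (q / p) :=
      Finset.sum_nonneg fun k _ => Real.rpow_nonneg (ht k) _
    rw [one_div_div q]
    refine mul_le_of_le_one_left (Real.rpow_nonneg h0 _) (Real.rpow_le_one (by positivity) ?_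
      (one_div_nonneg.2 (div_nonneg (inv_nonneg.2 hd.le) hp.le)))
    simpa only [← Real.rpow_mul (abs_nonneg _), mul_div_cancel₀ _ hp.ne'] using hβ

/-- Hölder's inequality for the exponents `q / p` and `r / p` is sharp. -/
theorem exists_le_sum_abs_rpow_mul (hp : 0 < p) (hpq : p ≤ q) {t : Fin n → ℝ}
    (ht : ∀ k, 0 ≤ t k) : ∃ β : Fin n → ℝ, ‖WithLp.toLp (gapExponent p q) β‖ ≤ 1 ∧
      (∑ k, t k ^ (q / p)) ^ (p / q) ≤ ∑ k, |β k| ^ p * t k := by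
  rcases hpq.eq_or_lt with rfl | hlt
  · refine ⟨1, (norm_toLp_le_one_iff_self p _).2 fun k => by simp, ?_⟩
    simp [div_self hp.ne']
  · have hq : 0 < q := hp.trans hlt
    have hd : 0 < 1 / p - 1 / q := sub_pos.2 (one_div_lt_one_div_of_lt hp hlt)
    set S := ∑ k, t k ^ (q / p) with hS
    have hS0 : 0 ≤ S := Finset.sum_nonneg fun k _ => Real.rpow_nonneg (ht k) _
    have hb : ∀ k, 0 ≤ t k ^ (q / p) / S := fun k => div_nonneg (Real.rpow_nonneg (ht k) _) hS0
    -- The equality case of Hölder: `βₖ^r` is proportional to `tₖ^{q/p}`. If `S = 0`, division by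
    -- zero gives `β = 0`, which is still admissible.
    refine ⟨fun k => (t k ^ (q / p) / S) ^ (1 / p - 1 / q), ?_, ?_⟩
    · rw [norm_toLp_le_one_iff_of_lt hp hlt]
      simp only [abs_of_nonneg (Real.rpow_nonneg (hb _) _), ← Real.rpow_mul (hb _),
        mul_inv_cancel₀ hd.ne', Real.rpow_one, ← Finset.sum_div]
      exact div_self_le_one S
    · rcases hS0.eq_or_lt with h0 | hpos
      · rw [← h0, Real.zero_rpow (by positivity)]
        exact Finset.sum_nonneg fun k _ => mul_nonneg (by positivity) (ht k)
      · refine le_of_eq ?_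
        have e : (1 / p - 1 / q) * p = 1 - p / q := by field_simp
        -- As `p/r = 1 - p/q` and `tₖ = (tₖ^{q/p})^{p/q}`, each term is `S^{p/q}` times the
        -- normalised weight `tₖ^{q/p}/S`. The case `tₖ = 0` is separate because `Real.rpow_sub`
        -- needs a positive base.
        have hk : ∀ k, |(t k ^ (q / p) / S) ^ (1 / p - 1 / q)| ^ p * t k =
            t k ^ (q / p) / S * S ^ (p / q) := fun k => by
          rw [abs_of_nonneg (Real.rpow_nonneg (hb _) _), ← Real.rpow_mul (hb _), e]
          rcases (ht k).eq_or_lt with h | h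
          · rw [← h, Real.zero_rpow (div_pos hq hp).ne']
            simp
          · have hpq1 : 0 < t k ^ (q / p) / S := by positivity
            rw [Real.rpow_sub hpq1, Real.rpow_one, Real.div_rpow (by positivity) hS0,
              ← Real.rpow_mul h.le, div_mul_div_cancel₀ hp.ne', div_self hq.ne', Real.rpow_one]
            field_simp
        simp only [hk, ← Finset.sum_mul, ← Finset.sum_div, ← hS, div_self hpos.ne', one_mul]

end GapExponent

/-! ### The dual formula for `strongNorm`. -/

section StrongNorm

variable {p q : ℝ} {X : Type*} [NormedAddCommGroup X] [Lattice X] [HasSolidNorm X]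
  [IsOrderedAddMonoid X] [NormedSpace ℝ X] [IsOrderedModule ℝ X] [CompleteSpace X]
  [IsPConvex p X] {n : ℕ}

theorem strongNorm_nonneg (x : Fin n → X) : 0 ≤ strongNorm p q x :=
  Real.iSup_nonneg fun _ => norm_nonneg _

theorem PosDualBall.continuous_rpow (hr : 0 ≤ q / p) (x : X) :
    Continuous fun φ : PosDualBall p X => φ.1 (Concavification.pow |x|) ^ (q / p) :=
  (Real.continuous_rpow_const hr).comp (PosDualBall.continuous_apply _)

/-- A positive functional norming the `p`-th power of the `lpSum` reduces this to the scalar Hölder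
inequality. The bound is uniform in `β`, so it both estimates `strongNorm` and shows that its
supremum runs over a bounded family. -/
theorem norm_lpSum_smul_le (hpq : p ≤ q) (x : Fin n → X) {M : ℝ}
    (hM : ∀ φ : PosDualBall p X, ∑ k, φ.1 (Concavification.pow |x k|) ^ (q / p) ≤ M)
    {β : Fin n → ℝ} (hβ : ‖WithLp.toLp (gapExponent p q) β‖ ≤ 1) :
    ‖lpSum p (fun k => β k • x k)‖ ≤ M ^ (1 / q) := by
  have hp := IsPConvex.pos p X
  have hq : 0 < q := hp.trans_le hpq
  have hpos : (0 : Concavification p X) ≤ Concavification.pow (lpSum p fun k => β k • x k) := by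
    rw [← Concavification.sum_pow_abs]
    exact Finset.sum_nonneg fun k _ => abs_nonneg (β k • x k)
  obtain ⟨φ, hφ⟩ := Concavification.exists_posDualBall_eq_norm hpos
  have hS0 : 0 ≤ ∑ k, φ.1 (Concavification.pow |x k|) ^ (q / p) :=
    Finset.sum_nonneg fun k _ => Real.rpow_nonneg (φ.apply_pow_abs_nonneg _) _
  have hM0 : 0 ≤ M := hS0.trans (hM φ)
  rw [φ.apply_pow_lpSum, Concavification.norm_def] at hφ
  refine (Real.rpow_le_rpow_iff (norm_nonneg _) (Real.rpow_nonneg hM0 _) hp).1 ?_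
  rw [← hφ, ← Real.rpow_mul hM0, one_div_mul_eq_div]
  exact (sum_abs_rpow_mul_le hp hpq hβ fun k => φ.apply_pow_abs_nonneg _).trans
    (Real.rpow_le_rpow hS0 (hM φ) (by positivity))

theorem exists_isMax_sum_apply_rpow (hpq : p ≤ q) (x : Fin n → X) :
    ∃ φ₀ : PosDualBall p X, ∀ φ : PosDualBall p X,
      ∑ k, φ.1 (Concavification.pow |x k|) ^ (q / p) ≤
        ∑ k, φ₀.1 (Concavification.pow |x k|) ^ (q / p) := by
  have hp := IsPConvex.pos p X
  have hr : 0 ≤ q / p := (div_pos (hp.trans_le hpq) hp).le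
  obtain ⟨φ₀, -, h⟩ := isCompact_univ.exists_isMaxOn Set.univ_nonempty
    (continuous_finsetSum Finset.univ fun k _ =>
      PosDualBall.continuous_rpow (p := p) hr (x k)).continuousOn
  exact ⟨φ₀, fun φ => h (Set.mem_univ φ)⟩

/-- One functional must serve all `β` at once; the maximiser on the compact `B⁺` does. In the
separation argument it is the point where a function of the cone is nonnegative. -/
theorem exists_strongNorm_rpow_le (hpq : p ≤ q) (x : Fin n → X) :
    ∃ φ : PosDualBall p X,
      strongNorm p q x ^ q ≤ ∑ k, φ.1 (Concavification.pow |x k|) ^ (q / p) := by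
  have hq : 0 < q := (IsPConvex.pos p X).trans_le hpq
  obtain ⟨φ₀, h⟩ := exists_isMax_sum_apply_rpow hpq x
  have hS0 : 0 ≤ ∑ k, φ₀.1 (Concavification.pow |x k|) ^ (q / p) :=
    Finset.sum_nonneg fun k _ => Real.rpow_nonneg (φ₀.apply_pow_abs_nonneg _) _
  refine ⟨φ₀, ?_⟩
  rw [← Real.le_rpow_inv_iff_of_pos (strongNorm_nonneg x) hS0 hq, ← one_div]
  exact Real.iSup_le (fun β => norm_lpSum_smul_le hpq x h β.2) (Real.rpow_nonneg hS0 _)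

/-- The `β` that is extremal in Hölder's inequality for the numbers `⟨|xₖ|^p, φ⟩` is a competitor in
the supremum, and `φ` has norm at most one. -/
theorem sum_apply_rpow_le_strongNorm_rpow (hpq : p ≤ q) (x : Fin n → X) (φ : PosDualBall p X) :
    ∑ k, φ.1 (Concavification.pow |x k|) ^ (q / p) ≤ strongNorm p q x ^ q := by
  have hp := IsPConvex.pos p X
  have hq : 0 < q := hp.trans_le hpq
  obtain ⟨φ₀, h⟩ := exists_isMax_sum_apply_rpow hpq x
  obtain ⟨β, hβ, hle⟩ := exists_le_sum_abs_rpow_mul hp hpq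
    (t := fun k => φ.1 (Concavification.pow |x k|)) fun k => φ.apply_pow_abs_nonneg _
  have hS0 : 0 ≤ ∑ k, φ.1 (Concavification.pow |x k|) ^ (q / p) :=
    Finset.sum_nonneg fun k _ => Real.rpow_nonneg (φ.apply_pow_abs_nonneg _) _
  have hsup : ‖lpSum p (fun k => β k • x k)‖ ≤ strongNorm p q x :=
    -- A real supremum dominates its terms only if the family is bounded above; the maximum over
    -- `B⁺` supplies the bound.
    le_ciSup (f := fun β : {β : PiLp (gapExponent p q) (fun _ : Fin n => ℝ) // ‖β‖ ≤ 1} =>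
      ‖lpSum p (fun k => β.1 k • x k)‖)
      ⟨_, by rintro _ ⟨β, rfl⟩; exact norm_lpSum_smul_le hpq x h β.2⟩ ⟨WithLp.toLp _ β, hβ⟩
  have h1 : (∑ k, φ.1 (Concavification.pow |x k|) ^ (q / p)) ^ (p / q) ≤ strongNorm p q x ^ p := by
    rw [← φ.apply_pow_lpSum] at hle
    exact (hle.trans (φ.apply_le_norm _)).trans (Real.rpow_le_rpow (norm_nonneg _) hsup hp.le)
  have h2 := Real.rpow_le_rpow (Real.rpow_nonneg hS0 _) h1 (div_pos hq hp).le
  rwa [← Real.rpow_mul hS0, ← Real.rpow_mul (strongNorm_nonneg x), div_mul_div_cancel₀ hq.ne',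
    div_self hp.ne', Real.rpow_one, mul_div_cancel₀ _ hp.ne'] at h2

end StrongNorm

/-! ### Weighted means and Hölder's inequality for several families. -/

section WeightedMeans

/-- The weighted geometric mean is the infimum of the rescaled weighted arithmetic means. -/
theorem le_prod_rpow_of_forall_mul_le {ι : Type*} [Fintype ι] {w s : ι → ℝ} (hw : ∀ j, 0 < w j)
    (hw1 : ∑ j, w j = 1) (hs : ∀ j, 0 ≤ s j) {A : ℝ}
    (h : ∀ t : ι → ℝ, (∀ j, 0 < t j) → A * ∏ j, t j ^ w j ≤ ∑ j, w j * (t j * s j)) :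
    A ≤ ∏ j, s j ^ w j := by
  -- The optimal choice `tⱼ = 1/sⱼ` makes the arithmetic mean equal to 1. Since `sⱼ` may vanish, it
  -- is replaced by `sⱼ + ε`, and `ε` tends to 0 at the end.
  have key : ∀ ε : ℝ, 0 < ε → A ≤ ∏ j, (s j + ε) ^ w j := by
    intro ε hε
    have hpos : ∀ j, 0 < s j + ε := fun j => add_pos_of_nonneg_of_pos (hs j) hε
    have h1 := h (fun j => (s j + ε)⁻¹) fun j => inv_pos.2 (hpos j)
    have h2 : ∑ j, w j * ((s j + ε)⁻¹ * s j) ≤ 1 := by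
      rw [← hw1]
      refine Finset.sum_le_sum fun j _ => mul_le_of_le_one_right (hw j).le ?_
      rw [inv_mul_le_iff₀ (hpos j)]
      linarith
    have h3 : ∏ j, ((s j + ε)⁻¹) ^ w j = (∏ j, (s j + ε) ^ w j)⁻¹ := by
      rw [← Finset.prod_inv_distrib]
      exact Finset.prod_congr rfl fun j _ => Real.inv_rpow (hpos j).le _
    have h4 : 0 < ∏ j, (s j + ε) ^ w j :=
      Finset.prod_pos fun j _ => Real.rpow_pos_of_pos (hpos j) _
    rw [h3] at h1
    have := h1.trans h2
    rwa [mul_inv_le_iff₀ h4, one_mul] at this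
  have hcont : Continuous fun ε : ℝ => ∏ j, (s j + ε) ^ w j :=
    continuous_finsetProd _ fun j _ =>
      (Real.continuous_rpow_const (hw j).le).comp (continuous_const.add continuous_id)
  have hlim := (hcont.tendsto 0).mono_left (nhdsWithin_le_nhds (s := Set.Ioi 0))
  simp only [add_zero] at hlim
  exact ge_of_tendsto hlim (Filter.eventually_of_mem self_mem_nhdsWithin key)

/-- Hölder's inequality for finitely many finite families. -/
theorem sum_prod_rpow_le {ι κ : Type*} [Fintype ι] [Fintype κ] {w : ι → ℝ} (hw : ∀ j, 0 < w j)
    (hw1 : ∑ j, w j = 1) {b : ι → κ → ℝ} (hb : ∀ j k, 0 ≤ b j k) :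
    ∑ k, ∏ j, b j k ^ w j ≤ ∏ j, (∑ k, b j k) ^ w j := by
  refine le_prod_rpow_of_forall_mul_le hw hw1 (fun j => Finset.sum_nonneg fun k _ => hb j k)
    fun t ht => ?_
  -- For fixed `t` this is the mean inequality applied term by term to `tⱼ bⱼₖ`; optimising over `t`
  -- restores the product of sums.
  calc (∑ k, ∏ j, b j k ^ w j) * ∏ j, t j ^ w j
      = ∑ k, ∏ j, (t j * b j k) ^ w j := by
        rw [Finset.sum_mul]
        refine Finset.sum_congr rfl fun k _ => ?_
        rw [mul_comm, ← Finset.prod_mul_distrib]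
        exact Finset.prod_congr rfl fun j _ => (Real.mul_rpow (ht j).le (hb j k)).symm
    _ ≤ ∑ k, ∑ j, w j * (t j * b j k) := Finset.sum_le_sum fun k _ =>
        Real.geom_mean_le_arith_mean_weighted _ _ _ (fun j _ => (hw j).le) hw1
          fun j _ => mul_nonneg (ht j).le (hb j k)
    _ = ∑ j, w j * (t j * ∑ k, b j k) := by
        rw [Finset.sum_comm]
        simp only [Finset.mul_sum]

end WeightedMeans

/-! ### States on `C(K)`: separation and Riesz representation. -/

section Separation

open CompactlySupported

variable {K : Type*} [TopologicalSpace K] [CompactSpace K]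

/-- A convex cone of continuous functions on a compact space, each of which is nonnegative
somewhere, admits a state that is nonnegative on it. -/
theorem exists_state_nonneg_of_convexCone [Nonempty K] (t : Set C(K, ℝ)) (h0 : 0 ∈ t)
    (hadd : ∀ f ∈ t, ∀ g ∈ t, f + g ∈ t) (hsmul : ∀ c : ℝ, 0 < c → ∀ f ∈ t, c • f ∈ t)
    (ht : ∀ f ∈ t, ∃ x, 0 ≤ f x) :
    ∃ Λ : C(K, ℝ) →ₗ[ℝ] ℝ, (∀ f, 0 ≤ f → 0 ≤ Λ f) ∧ Λ 1 = 1 ∧ ∀ f ∈ t, 0 ≤ Λ f := by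
  -- The strictly negative functions form a convex set, open because `K` is compact, and disjoint
  -- from `t` by `ht`.
  let s : Set C(K, ℝ) := {f | ∀ x, f x < 0}
  have hs1 : Convex ℝ s := by
    intro f hf g hg a b ha hb hab x
    have h1 := hf x
    have h2 := hg x
    simp only [ContinuousMap.add_apply, ContinuousMap.smul_apply, smul_eq_mul]
    rcases ha.eq_or_lt with rfl | ha
    · simp_all
    · nlinarith
  have hs2 : IsOpen s := by
    have := ContinuousMap.isOpen_setOfPred_mapsTo (X := K) isCompact_univ (isOpen_Iio (a := (0 : ℝ)))
    simpa [Set.MapsTo] using this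
  have ht1 : Convex ℝ t := by
    intro f hf g hg a b ha hb hab
    rcases ha.eq_or_lt with rfl | ha
    · simp_all
    · rcases hb.eq_or_lt with rfl | hb
      · simp_all
      · exact hadd _ (hsmul a ha f hf) _ (hsmul b hb g hg)
  have hdisj : Disjoint s t := Set.disjoint_left.2 fun f hf hft => by
    obtain ⟨x, hx⟩ := ht f hft
    exact absurd (hf x) (not_lt.2 hx)
  obtain ⟨L, u, hLs, hLt⟩ := geometric_hahn_banach_open hs1 hs2 ht1 hdisj
  have hu0 : u ≤ 0 := by simpa using hLt 0 h0
  -- Testing `L < u` on small negative constants is what normalises the functional: `ε = 1` with `u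
  -- ≤ 0` gives `L 1 > 0`, and `ε → 0` gives `u ≥ 0`, hence `L ≥ 0` on `t`.
  have hneg1 : ∀ ε : ℝ, 0 < ε → -(ε * L 1) < u := fun ε hε => by
    have := hLs (-(ε • (1 : C(K, ℝ)))) fun x => by simpa using hε
    simpa using this
  have hL1 : 0 < L 1 := by
    have := hneg1 1 one_pos
    linarith
  have hpos : ∀ f : C(K, ℝ), 0 ≤ f → 0 ≤ L f := fun f hf => by
    refine le_of_forall_pos_le_add fun δ hδ => ?_
    -- The small constant makes the negative of `f ≥ 0` strictly negative, so that it lies in `s`.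
    have := hLs (-(f + (δ / L 1) • (1 : C(K, ℝ)))) fun x => by
      have h1 : 0 ≤ f x := hf x
      have h2 : 0 < δ / L 1 := div_pos hδ hL1
      simp only [ContinuousMap.neg_apply, ContinuousMap.add_apply, ContinuousMap.smul_apply,
        ContinuousMap.one_apply, smul_eq_mul]
      linarith
    simp only [map_neg, map_add, map_smul, smul_eq_mul, div_mul_cancel₀ _ hL1.ne'] at this
    linarith
  have hu : 0 ≤ u := by
    refine le_of_forall_pos_le_add fun δ hδ => ?_
    have := hneg1 (δ / L 1) (div_pos hδ hL1)
    rw [div_mul_cancel₀ _ hL1.ne'] at this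
    linarith
  refine ⟨(L 1)⁻¹ • (L : C(K, ℝ) →ₗ[ℝ] ℝ), fun f hf => ?_, ?_, fun f hf => ?_⟩
  · exact mul_nonneg (inv_pos.2 hL1).le (hpos f hf)
  · exact inv_mul_cancel₀ hL1.ne'
  · exact mul_nonneg (inv_pos.2 hL1).le (hu.trans (hLt f hf))

/-- The Riesz representation theorem for states on `C(K)`. -/
theorem exists_isProbabilityMeasure_integral_eq [T2Space K] [MeasurableSpace K] [BorelSpace K]
    (Λ : C(K, ℝ) →ₗ[ℝ] ℝ) (hΛ : ∀ f, 0 ≤ f → 0 ≤ Λ f) (h1 : Λ 1 = 1) :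
    ∃ ν : Measure K, IsProbabilityMeasure ν ∧ ∀ f : C(K, ℝ), ∫ x, f x ∂ν = Λ f := by
  -- On compact `K` every continuous function has compact support, so the Riesz theorem for `C_c(K,
  -- ℝ)` covers `C(K, ℝ)`.
  let Λ₀ : C_c(K, ℝ) →ₗ[ℝ] ℝ :=
    { toFun := fun f => Λ f.toContinuousMap
      map_add' := fun f g => map_add Λ f.toContinuousMap g.toContinuousMap
      map_smul' := fun c f => map_smul Λ c f.toContinuousMap }
  let Λ' : C_c(K, ℝ) →ₚ[ℝ] ℝ := PositiveLinearMap.mk₀ Λ₀ fun f hf => hΛ _ fun x => hf x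
  have hint : ∀ f : C(K, ℝ), ∫ x, f x ∂(RealRMK.rieszMeasure Λ') = Λ f := fun f =>
    RealRMK.integral_rieszMeasure Λ' (CompactlySupportedContinuousMap.continuousMapEquiv f)
  refine ⟨RealRMK.rieszMeasure Λ', ?_, hint⟩
  have h := hint 1
  simp only [ContinuousMap.one_apply, integral_const, smul_eq_mul, mul_one, h1] at h
  exact ⟨(ENNReal.toReal_eq_one_iff _).1 h⟩

end Separation

/-! ### The functions `⟨|x|^p, φ⟩^{q/p}` and their integrals. -/

section PosDualBall

variable {p q : ℝ} {X : Type*} [NormedAddCommGroup X] [Lattice X] [HasSolidNorm X]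
  [IsOrderedAddMonoid X] [NormedSpace ℝ X] [IsOrderedModule ℝ X] [CompleteSpace X]
  [IsPConvex p X]

/-- The continuous function `φ ↦ ⟨|x|^p, φ⟩^{q/p}` on `B⁺`. -/
noncomputable def PosDualBall.evalRpow (hpq : p ≤ q) (x : X) : C(PosDualBall p X, ℝ) where
  toFun φ := φ.1 (Concavification.pow |x|) ^ (q / p)
  continuous_toFun := PosDualBall.continuous_rpow
    (div_pos ((IsPConvex.pos p X).trans_le hpq) (IsPConvex.pos p X)).le x

theorem PosDualBall.evalRpow_nonneg (hpq : p ≤ q) (x : X) (φ : PosDualBall p X) :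
    0 ≤ PosDualBall.evalRpow hpq x φ :=
  Real.rpow_nonneg (φ.apply_pow_abs_nonneg x) _

/-- The function is homogeneous of degree `q` in `x`. This scaling gives the cone property and
drives the final optimisation over `t`. -/
theorem PosDualBall.evalRpow_smul (hpq : p ≤ q) {c : ℝ} (hc : 0 ≤ c) (x : X) :
    PosDualBall.evalRpow (p := p) hpq (c ^ (1 / q) • x) = c • PosDualBall.evalRpow hpq x := by
  have hp := IsPConvex.pos p X
  have hq : 0 < q := hp.trans_le hpq
  ext φ
  change φ.1 (Concavification.pow |c ^ (1 / q) • x|) ^ (q / p) =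
    c * φ.1 (Concavification.pow |x|) ^ (q / p)
  have hc' : 0 ≤ c ^ (1 / q) := Real.rpow_nonneg hc _
  rw [φ.apply_pow_abs_smul, abs_of_nonneg hc',
    Real.mul_rpow (Real.rpow_nonneg hc' _) (φ.apply_pow_abs_nonneg x), ← Real.rpow_mul hc',
    mul_div_cancel₀ _ hp.ne', ← Real.rpow_mul hc, one_div_mul_cancel hq.ne', Real.rpow_one]

theorem PosDualBall.integral_evalRpow_nonneg (hpq : p ≤ q) (x : X)
    (ν : Measure (PosDualBall p X)) : 0 ≤ ∫ φ, PosDualBall.evalRpow hpq x φ ∂ν :=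
  integral_nonneg fun φ => PosDualBall.evalRpow_nonneg hpq x φ

theorem PosDualBall.sum_integral_evalRpow_le (hpq : p ≤ q) {n : ℕ} (x : Fin n → X)
    (ν : Measure (PosDualBall p X)) [IsProbabilityMeasure ν] :
    ∑ k, ∫ φ, PosDualBall.evalRpow hpq (x k) φ ∂ν ≤ strongNorm p q x ^ q := by
  have hint : ∀ f : C(PosDualBall p X, ℝ), Integrable f ν := fun f =>
    f.continuous.integrable_of_hasCompactSupport (HasCompactSupport.of_compactSpace f)
  rw [← integral_finsetSum _ fun k _ => hint _]
  refine (integral_mono (integrable_finsetSum _ fun k _ => hint _)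
    (integrable_const (strongNorm p q x ^ q)) fun φ =>
      sum_apply_rpow_le_strongNorm_rpow hpq x φ).trans ?_
  simp

end PosDualBall

/-! ### Arithmetic of the exponents; the weights are `Q/qⱼ`. -/

section Exponents

variable {m : ℕ} {q : Fin m → ℝ} {Q : ℝ}

/-- At least one index is needed: an empty sum would give `1/Q = 0`. -/
theorem pos_of_one_div_eq_sum (hm : 1 ≤ m) (hq : ∀ j, 0 < q j) (hQ : 1 / Q = ∑ j, 1 / q j) :
    0 < Q := by
  have : Nonempty (Fin m) := ⟨⟨0, hm⟩⟩
  rw [← one_div_pos, hQ]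
  exact Finset.sum_pos (fun j _ => one_div_pos.2 (hq j)) Finset.univ_nonempty

theorem sum_div_eq_one (hQ0 : 0 < Q) (hQ : 1 / Q = ∑ j, 1 / q j) : ∑ j, Q / q j = 1 := by
  rw [← mul_one_div_cancel hQ0.ne', hQ, Finset.mul_sum]
  simp only [mul_one_div]

theorem mul_prod_rpow_one_div_rpow {C : ℝ} (hC : 0 ≤ C) {a : Fin m → ℝ} (ha : ∀ j, 0 ≤ a j) :
    (C * ∏ j, a j ^ (1 / q j)) ^ Q = C ^ Q * ∏ j, a j ^ (Q / q j) := by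
  rw [Real.mul_rpow hC (Finset.prod_nonneg fun j _ => Real.rpow_nonneg (ha j) _),
    ← Real.finsetProd_rpow _ _ fun j _ => Real.rpow_nonneg (ha j) _]
  simp only [← Real.rpow_mul (ha _), one_div_mul_eq_div]

end Exponents

/-! ### The two implications. -/

section Factorization

variable {m : ℕ} {X : Fin m → Type*} [∀ j, NormedAddCommGroup (X j)]
  [∀ j, Lattice (X j)] [∀ j, HasSolidNorm (X j)] [∀ j, IsOrderedAddMonoid (X j)]
  [∀ j, NormedSpace ℝ (X j)] [∀ j, IsOrderedModule ℝ (X j)] [∀ j, CompleteSpace (X j)]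
  {E : Type*} [NormedAddCommGroup E] [NormedSpace ℝ E]
  {p q : Fin m → ℝ} [∀ j, IsPConvex (p j) (X j)] {Q : ℝ}

theorem norm_map_rpow_smul_rpow (T : MultilinearMap ℝ X E) {t : Fin m → ℝ} (ht : ∀ j, 0 ≤ t j)
    (x : ∀ j, X j) :
    ‖T fun j => t j ^ (1 / q j) • x j‖ ^ Q = ‖T x‖ ^ Q * ∏ j, t j ^ (Q / q j) := by
  rw [T.map_smul_univ, norm_smul,
    Real.norm_of_nonneg (Finset.prod_nonneg fun j _ => Real.rpow_nonneg (ht j) _), mul_comm,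
    mul_prod_rpow_one_div_rpow (norm_nonneg _) ht]

/-- An integral domination gives strong concavity, by Hölder's inequality. -/
theorem isStronglyConcave_of_integral_bound (hm : 1 ≤ m) (hpq : ∀ j, p j ≤ q j)
    (hQ : 1 / Q = ∑ j, 1 / q j) (T : MultilinearMap ℝ X E) {C : ℝ} (hC : 0 < C)
    (ν : ∀ j, Measure (PosDualBall (p j) (X j))) [∀ j, IsProbabilityMeasure (ν j)]
    (hT : ∀ x : ∀ j, X j, ‖T x‖ ≤
      C * ∏ j, (∫ φ, PosDualBall.evalRpow (hpq j) (x j) φ ∂ν j) ^ (1 / q j)) :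
    IsStronglyConcave p q Q T := by
  have hq : ∀ j, 0 < q j := fun j => (IsPConvex.pos (p j) (X j)).trans_le (hpq j)
  have hQ0 := pos_of_one_div_eq_sum hm hq hQ
  have hw : ∀ j, 0 < Q / q j := fun j => div_pos hQ0 (hq j)
  refine ⟨C, hC, fun n x => ?_⟩
  have hI : ∀ j (y : X j), 0 ≤ ∫ φ, PosDualBall.evalRpow (hpq j) y φ ∂ν j := fun j y =>
    PosDualBall.integral_evalRpow_nonneg (hpq j) y (ν j)
  have hN : ∀ j, 0 ≤ strongNorm (p j) (q j) (x j) := fun j => strongNorm_nonneg _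
  have hRHS : 0 ≤ C * ∏ j, strongNorm (p j) (q j) (x j) :=
    mul_nonneg hC.le (Finset.prod_nonneg fun j _ => hN j)
  have hS : 0 ≤ ∑ k, ‖T (fun j => x j k)‖ ^ Q := by positivity
  rw [one_div, Real.rpow_inv_le_iff_of_pos hS hRHS hQ0]
  calc ∑ k, ‖T (fun j => x j k)‖ ^ Q
      ≤ ∑ k, C ^ Q * ∏ j, (∫ φ, PosDualBall.evalRpow (hpq j) (x j k) φ ∂ν j) ^ (Q / q j) := by
        refine Finset.sum_le_sum fun k _ => ?_
        rw [← mul_prod_rpow_one_div_rpow hC.le fun j => hI j _]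
        exact Real.rpow_le_rpow (norm_nonneg _) (hT _) hQ0.le
    -- Hölder with the weights `Q/qⱼ` moves the sum over `k` inside the product.
    _ ≤ C ^ Q * ∏ j, (∑ k, ∫ φ, PosDualBall.evalRpow (hpq j) (x j k) φ ∂ν j) ^ (Q / q j) := by
        rw [← Finset.mul_sum]
        exact mul_le_mul_of_nonneg_left
          (sum_prod_rpow_le hw (sum_div_eq_one hQ0 hQ) fun j k => hI j (x j k)) (by positivity)
    _ ≤ C ^ Q * ∏ j, (strongNorm (p j) (q j) (x j) ^ q j) ^ (Q / q j) := by
        gcongr with j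
        · exact fun j _ => Real.rpow_nonneg (Finset.sum_nonneg fun k _ => hI j _) _
        · exact Finset.sum_nonneg fun k _ => hI j _
        · exact (hw j).le
        · exact PosDualBall.sum_integral_evalRpow_le (hpq j) (x j) (ν j)
    _ = (C * ∏ j, strongNorm (p j) (q j) (x j)) ^ Q := by
        rw [← mul_prod_rpow_one_div_rpow hC.le fun j => Real.rpow_nonneg (hN j) _]
        simp only [one_div, Real.rpow_rpow_inv (hN _) (hq _).ne']

/-- The continuous function
`(φ₁, …, φₘ) ↦ A ∑ⱼ (Q/qⱼ) ⟨|xⱼ|^{pⱼ}, φⱼ⟩^{qⱼ/pⱼ} - ‖T(x₁, …, xₘ)‖^Q` on `∏ⱼ Bⱼ⁺`. -/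
noncomputable def dominationGap (hpq : ∀ j, p j ≤ q j) (Q A : ℝ) (T : MultilinearMap ℝ X E)
    (x : ∀ j, X j) : C(∀ j, PosDualBall (p j) (X j), ℝ) :=
  A • ∑ j, (Q / q j) • (PosDualBall.evalRpow (hpq j) (x j)).comp (ContinuousMap.eval j) -
    ‖T x‖ ^ Q • 1

theorem dominationGap_apply (hpq : ∀ j, p j ≤ q j) (A : ℝ) (T : MultilinearMap ℝ X E)
    (x : ∀ j, X j) (φ : ∀ j, PosDualBall (p j) (X j)) :
    dominationGap hpq Q A T x φ =
      A * ∑ j, Q / q j * PosDualBall.evalRpow (hpq j) (x j) (φ j) - ‖T x‖ ^ Q := by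
  simp [dominationGap]

/-- Scaling `xⱼ` by `c^{1/qⱼ}` multiplies every summand by `c`, and also `‖T x‖^Q`, because the
exponents `Q/qⱼ` add up to 1. Hence the sums of these functions are closed under positive multiples.
-/
theorem dominationGap_smul (hpq : ∀ j, p j ≤ q j) (hQ0 : 0 < Q) (hQ : 1 / Q = ∑ j, 1 / q j)
    (A : ℝ) (T : MultilinearMap ℝ X E) {c : ℝ} (hc : 0 < c) (x : ∀ j, X j) :
    dominationGap hpq Q A T (fun j => c ^ (1 / q j) • x j) = c • dominationGap hpq Q A T x := by
  ext φ
  rw [ContinuousMap.smul_apply, dominationGap_apply, dominationGap_apply,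
    norm_map_rpow_smul_rpow T (t := fun _ => c) fun _ => hc.le,
    ← Real.rpow_sum_of_pos hc, sum_div_eq_one hQ0 hQ, Real.rpow_one]
  simp only [PosDualBall.evalRpow_smul _ hc.le, ContinuousMap.smul_apply, smul_eq_mul]
  rw [mul_sub, mul_comm c (‖T x‖ ^ Q), mul_left_comm, Finset.mul_sum _ _ c]
  simp only [mul_left_comm c]

/-- Strong concavity gives an integral domination, by separation in `C(∏ⱼ Bⱼ⁺)`. -/
theorem exists_integral_bound_of_isStronglyConcave (hm : 1 ≤ m) (hpq : ∀ j, p j ≤ q j)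
    (hQ : 1 / Q = ∑ j, 1 / q j) (T : MultilinearMap ℝ X E) (h : IsStronglyConcave p q Q T) :
    ∃ C > 0, ∃ ν : ∀ j, Measure (PosDualBall (p j) (X j)),
      (∀ j, IsProbabilityMeasure (ν j)) ∧ ∀ x : ∀ j, X j, ‖T x‖ ≤
        C * ∏ j, (∫ φ, PosDualBall.evalRpow (hpq j) (x j) φ ∂ν j) ^ (1 / q j) := by
  have hq : ∀ j, 0 < q j := fun j => (IsPConvex.pos (p j) (X j)).trans_le (hpq j)
  have hQ0 := pos_of_one_div_eq_sum hm hq hQ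
  have hw : ∀ j, 0 < Q / q j := fun j => div_pos hQ0 (hq j)
  have hw1 := sum_div_eq_one hQ0 hQ
  obtain ⟨C, hC, hT⟩ := h
  have hCQ : 0 < C ^ Q := Real.rpow_pos_of_pos hC Q
  obtain ⟨Λ, hΛ, hΛ1, hΛt⟩ := exists_state_nonneg_of_convexCone
    {f : C(∀ j, PosDualBall (p j) (X j), ℝ) | ∃ (n : ℕ) (x : Fin n → ∀ j, X j),
      f = ∑ k, dominationGap hpq Q (C ^ Q) T (x k)}
    ⟨0, Fin.elim0, by simp⟩
    (by
      rintro _ ⟨a, x, rfl⟩ _ ⟨b, y, rfl⟩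
      exact ⟨a + b, Fin.append x y, by simp [Fin.sum_univ_add]⟩)
    (by
      rintro c hc _ ⟨n, x, rfl⟩
      refine ⟨n, fun k j => c ^ (1 / q j) • x k j, ?_⟩
      simp only [dominationGap_smul hpq hQ0 hQ _ T hc, Finset.smul_sum])
    (by
      rintro _ ⟨n, x, rfl⟩
      -- The point of nonnegativity is chosen coordinate by coordinate: `φⱼ` attains the dual
      -- formula for the sequence of `j`-th entries.
      choose φ hφ using fun j => exists_strongNorm_rpow_le (hpq j) fun k => x k j
      refine ⟨φ, ?_⟩
      have hN : ∀ j, 0 ≤ strongNorm (p j) (q j) fun k => x k j := fun j => strongNorm_nonneg _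
      have hRHS : 0 ≤ C * ∏ j, strongNorm (p j) (q j) fun k => x k j :=
        mul_nonneg hC.le (Finset.prod_nonneg fun j _ => hN j)
      have h1 := hT n fun j k => x k j
      rw [one_div, Real.rpow_inv_le_iff_of_pos (by positivity) hRHS hQ0] at h1
      have h2 : (C * ∏ j, strongNorm (p j) (q j) fun k => x k j) ^ Q =
          C ^ Q * ∏ j, ((strongNorm (p j) (q j) fun k => x k j) ^ q j) ^ (Q / q j) := by
        rw [← mul_prod_rpow_one_div_rpow hC.le fun j => Real.rpow_nonneg (hN j) _]
        simp only [one_div, Real.rpow_rpow_inv (hN _) (hq _).ne']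
      have h3 := Real.geom_mean_le_arith_mean_weighted Finset.univ (fun j => Q / q j)
        (fun j => (strongNorm (p j) (q j) fun k => x k j) ^ q j) (fun j _ => (hw j).le) hw1
        fun j _ => Real.rpow_nonneg (hN j) _
      have h4 : ∑ j, Q / q j * (strongNorm (p j) (q j) fun k => x k j) ^ q j ≤
          ∑ j, Q / q j * ∑ k, PosDualBall.evalRpow (hpq j) (x k j) (φ j) :=
        Finset.sum_le_sum fun j _ => mul_le_mul_of_nonneg_left (hφ j) (hw j).le
      have h5 := mul_le_mul_of_nonneg_left (h3.trans h4) hCQ.le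
      rw [← h2] at h5
      simp only [ContinuousMap.sum_apply, dominationGap_apply, Finset.sum_sub_distrib]
      rw [← Finset.mul_sum, Finset.sum_comm, sub_nonneg]
      simp only [← Finset.mul_sum]
      exact h1.trans h5)
  -- Each summand of `dominationGap` depends on a single coordinate, so only the marginals of the
  -- state need to be represented by measures.
  have hmarg : ∀ j, ∃ ν : Measure (PosDualBall (p j) (X j)), IsProbabilityMeasure ν ∧
      ∀ f : C(PosDualBall (p j) (X j), ℝ), ∫ φ, f φ ∂ν = Λ (f.comp (ContinuousMap.eval j)) :=
    fun j => exists_isProbabilityMeasure_integral_eq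
      { toFun := fun f => Λ (f.comp (ContinuousMap.eval j))
        map_add' := fun f g => map_add Λ (f.comp _) (g.comp _)
        map_smul' := fun c f => map_smul Λ c (f.comp _) }
      (fun f hf => hΛ _ fun φ => hf (φ j)) hΛ1
  choose ν hν hνΛ using hmarg
  refine ⟨C, hC, ν, hν, fun x => ?_⟩
  have hI : ∀ j, 0 ≤ ∫ φ, PosDualBall.evalRpow (hpq j) (x j) φ ∂ν j := fun j =>
    PosDualBall.integral_evalRpow_nonneg (hpq j) (x j) (ν j)
  have hsum : ∀ y : ∀ j, X j, ‖T y‖ ^ Q ≤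
      C ^ Q * ∑ j, Q / q j * ∫ φ, PosDualBall.evalRpow (hpq j) (y j) φ ∂ν j := fun y => by
    have := hΛt (dominationGap hpq Q (C ^ Q) T y) ⟨1, fun _ => y, by simp⟩
    simp only [dominationGap, map_sub, map_smul, map_sum, hΛ1, smul_eq_mul, mul_one] at this
    simp only [hνΛ]
    exact sub_nonneg.1 this
  -- Applying `hsum` to `tⱼ^{1/qⱼ} xⱼ` multiplies the left side by `∏ tⱼ^{Q/qⱼ}` and the `j`-th
  -- integral by `tⱼ`, which is the hypothesis for passing from arithmetic to geometric means.
  have hle := le_prod_rpow_of_forall_mul_le hw hw1 hI (A := ‖T x‖ ^ Q / C ^ Q) fun t ht => by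
    have := hsum fun j => t j ^ (1 / q j) • x j
    rw [norm_map_rpow_smul_rpow T fun j => (ht j).le] at this
    simp only [PosDualBall.evalRpow_smul _ (ht _).le, ContinuousMap.smul_apply, smul_eq_mul,
      integral_const_mul] at this
    rw [div_mul_eq_mul_div, div_le_iff₀' hCQ]
    exact this
  rw [div_le_iff₀' hCQ, ← mul_prod_rpow_one_div_rpow hC.le hI] at hle
  exact (Real.rpow_le_rpow_iff (norm_nonneg _) (mul_nonneg hC.le
    (Finset.prod_nonneg fun j _ => Real.rpow_nonneg (hI j) _)) hQ0).1 hle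

end Factorization

theorem theorem3p2 {m : ℕ} (hm : 1 ≤ m) {X : Fin m → Type*} [∀ j, NormedAddCommGroup (X j)]
    [∀ j, Lattice (X j)] [∀ j, HasSolidNorm (X j)] [∀ j, IsOrderedAddMonoid (X j)]
    [∀ j, NormedSpace ℝ (X j)] [∀ j, IsOrderedModule ℝ (X j)] [∀ j, CompleteSpace (X j)]
    {E : Type*} [NormedAddCommGroup E] [NormedSpace ℝ E] [CompleteSpace E]
    (p q : Fin m → ℝ) [∀ j, IsPConvex (p j) (X j)] (hpq : ∀ j, p j ≤ q j)
    (Q : ℝ) (hQ : 1 / Q = ∑ j, 1 / q j) (T : MultilinearMap ℝ X E) :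
    IsStronglyConcave p q Q T ↔
      ∃ C > 0, ∃ ν : ∀ j, Measure (PosDualBall (p j) (X j)),
        (∀ j, IsProbabilityMeasure (ν j)) ∧
        ∀ x : ∀ j, X j,
          ‖T x‖ ≤ C * ∏ j, (∫ φ, (φ.1 (Concavification.pow |x j|)) ^ (q j / p j) ∂ν j)
            ^ (1 / q j) :=
  ⟨exists_integral_bound_of_isStronglyConcave hm hpq hQ T, fun ⟨_, hC, ν, _, hT⟩ =>
    isStronglyConcave_of_integral_bound hm hpq hQ T hC ν hT⟩
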